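/- Let $\mathbb K$ be a field and let $y_i=(\phi_i(t),\psi_i(u))\in\mathbb K[[t]]\times\mathbb K[[u]]$, $i=1,\dots,n$, parametrize an algebroid curve with two branches $$R=\mathbb K[[(\phi_1(t),\psi_1(u)),\dots,(\phi_n(t),\psi_n(u))]]\subseteq \mathbb K[[t]]\times\mathbb K[[u]],$$ i.e. $R$ (the closure of the $\mathbb K$-algebra generated by the $y_i$) is local, and $\mathbb K[[t]]\times\mathbb K[[u]]$ is its normalization: every element of $\mathbb K[[t]]\times\mathbb K[[u]]$ is a fraction $a/b$ with $a,b\in R$ and $b$ regular. Write $\nu(z_1,z_2)=(\operatorname{ord}z_1,\operatorname{ord}z_2)$, and for a ring $S\subseteq\mathbb K[[t]]\times\mathbb K[[u]]$ let $\nu(S)\subseteq\mathbb N^2$ be the set of all finite values $\nu(s)$, $s\in S$. A ring $S$ with $\mathbb K\subseteq S\subseteq\mathbb K[[t]]\times\mathbb K[[u]]$ is Arf if, for every regular $x\in S$, the set $\{x^{-1}r: r\in S,\ \nu(r)\ge\nu(x)\}$ is a ring; $R^*$ denotes the smallest Arf ring containing $R$. The conductor of a semigroup $S\subseteq\mathbb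 N^2$ is the least $\delta$ with $\delta+\mathbb N^2\subseteq S$. Blow-up algorithm. For a local ring $S$ with maximal ideal $\mathfrak m$, in $\mathbb K[[t]]\times\mathbb K[[u]]$ or in $\mathbb K[[t]]$ or in $\mathbb K[[u]]$, let $\operatorname{mult}(S)$ be the least value of an element of $\mathfrak m$, and for $x\in\mathfrak m$ of value $\operatorname{mult}(S)$ let $[x^{-1}S]$ be the ring generated by $x^{-1}\mathfrak m$. If $S\subseteq\mathbb K[[t]]\times\mathbb K[[u]]$ is local, put $\operatorname{mult}^*(S)=\{\operatorname{mult}(S)\}$; if $S=S_1\times S_2$ with $S_1\subseteq\mathbb K[[t]]$ and $S_2\subseteq\mathbb K[[u]]$ local, put $\operatorname{mult}^*(S)=\{(\operatorname{mult}(S_1),0),(0,\operatorname{mult}(S_2))\}$. The algorithm starts with $R_1=R$; while $\operatorname{mult}^*(R_m)\ne\{(1,0),(0,1)\}$, it sets $R_{m+1}=[x^{-1}R_m]$ if $R_m$ is local, and $R_{m+1}=[x_1^{-1}S_1]\times[x_2^{-1}S_2]$ if $R_m=S_1\times S_2$, where $x$ (respectively $x_1,x_2$) is any element of minimal value of the maximal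 ideal; it halts as soon as $\operatorname{mult}^*(R_m)=\{(1,0),(0,1)\}$. The multiplicity tree has the elements of $\operatorname{mult}^*(R_i)$ as its nodes on level $i$, for $1\le i\le m$, and two nodes on consecutive levels are linked if and only if their scalar product is nonzero. **Theorem.** The conductor $c=(c[1],c[2])$ of $\nu(R^*)$ exists. Let $\overline{\phi_i}$ and $\overline{\psi_i}$ be obtained from $\phi_i$ and $\psi_i$ by removing all terms of degree greater than $c[1]+1$ and $c[2]+1$ respectively, and let $\overline R=\mathbb K[[(\overline{\phi_1},\overline{\psi_1}),\dots,(\overline{\phi_n},\overline{\psi_n})]]$. Then the algorithm has a run that halts on $R$ and one that halts on $\overline R$, and every halting run on $R$ and every halting run on $\overline R$ yield the same multiplicity tree. -/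

import Mathlib

open scoped PowerSeries

noncomputable section

namespace AlgebroidCurve

variable {K : Type*} [Field K]

/-- The ring `K[[t]] × K[[u]]`; both variables are the variable `X` of `K⟦X⟧`. -/
abbrev Ambient (K : Type*) [Field K] : Type _ := K⟦X⟧ × K⟦X⟧

/-- The valuation vector `ν(z) = (ord z₁, ord z₂)`, with `ord 0 = ⊤`. -/
def val (z : Ambient K) : ℕ∞ × ℕ∞ := (z.1.order, z.2.order)

/-- The value set `ν(S) ⊆ ℕ²`: the valuation vectors of the elements of `S` for which both
components are finite. -/
def valueSet (S : Subalgebra K (Ambient K)) : Set (ℕ × ℕ) :=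
  {v | ∃ s ∈ S, val s = ((v.1 : ℕ∞), (v.2 : ℕ∞))}

/-- `K[[y₁, …, yₙ]]` inside `K[[t]] × K[[u]]`: the closure, for the topology given by the orders,
of the `K`-algebra generated by the `yᵢ`. -/
def seriesRing {n : ℕ} (y : Fin n → Ambient K) : Subalgebra K (Ambient K) where
  carrier := {z | ∀ N : ℕ, ∃ p ∈ Algebra.adjoin K (Set.range y),
    ((N : ℕ∞), (N : ℕ∞)) ≤ val (z - p)}
  mul_mem' := by
    intro a b ha hb N
    obtain ⟨p, hp, hp1, hp2⟩ := ha N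
    obtain ⟨q, hq, hq1, hq2⟩ := hb N
    have key : ∀ f g h k : K⟦X⟧, (N : ℕ∞) ≤ (f - h).order → (N : ℕ∞) ≤ (g - k).order →
        (N : ℕ∞) ≤ (f * g - h * k).order := by
      intro f g h k h1 h2
      have e : f * g - h * k = (f - h) * g + h * (g - k) := by ring
      rw [e]
      refine le_trans (le_min ?_ ?_) (PowerSeries.min_order_le_order_add _ _)
      · exact le_trans (le_trans h1 le_self_add) (PowerSeries.le_order_mul _ _)
      · exact le_trans (le_trans h2 le_add_self) (PowerSeries.le_order_mul _ _)
    exact ⟨p * q, mul_mem hp hq, key _ _ _ _ hp1 hq1, key _ _ _ _ hp2 hq2⟩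
  add_mem' := by
    intro a b ha hb N
    obtain ⟨p, hp, hp1, hp2⟩ := ha N
    obtain ⟨q, hq, hq1, hq2⟩ := hb N
    have key : ∀ f g h k : K⟦X⟧, (N : ℕ∞) ≤ (f - h).order → (N : ℕ∞) ≤ (g - k).order →
        (N : ℕ∞) ≤ (f + g - (h + k)).order := by
      intro f g h k h1 h2
      have e : f + g - (h + k) = (f - h) + (g - k) := by ring
      rw [e]
      exact le_trans (le_min h1 h2) (PowerSeries.min_order_le_order_add _ _)
    exact ⟨p + q, add_mem hp hq, key _ _ _ _ hp1 hq1, key _ _ _ _ hp2 hq2⟩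
  algebraMap_mem' := by
    intro r N
    exact ⟨algebraMap K (Ambient K) r, Subalgebra.algebraMap_mem _ r, by simp [val]⟩

/-- `y` parametrizes an algebroid curve with two branches: `R = K[[y₁, …, yₙ]]` is local and
`K[[t]] × K[[u]]` is its normalization, that is, every element of `K[[t]] × K[[u]]` is a fraction
`a / b` with `a, b ∈ R` and `b` regular.  (Integrality over `R` is then automatic.) -/
structure IsTwoBranchCurve {n : ℕ} (y : Fin n → Ambient K) : Prop where
  isLocal : IsLocalRing (seriesRing y)
  fraction : ∀ z : Ambient K, ∃ a ∈ seriesRing y, ∃ b ∈ seriesRing y,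
    b.1 ≠ 0 ∧ b.2 ≠ 0 ∧ b * z = a

/-! ### Arf closure and conductor -/

/-- `S` is an Arf ring: for every `x ∈ S` whose valuation `α = ν(x)` is finite, the set
`x⁻¹ S(α)` is a ring, where `S(α) = {r ∈ S : ν(r) ≥ α}`. -/
def IsArf (S : Subalgebra K (Ambient K)) : Prop :=
  ∀ x ∈ S, x.1 ≠ 0 → x.2 ≠ 0 →
    ∃ T : Subring (Ambient K), (T : Set (Ambient K)) = {z | ∃ r ∈ S, val x ≤ val r ∧ x * z = r}

/-- The Arf closure of `R`, the smallest Arf ring containing `R`. -/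
def arfClosure (R : Subalgebra K (Ambient K)) : Subalgebra K (Ambient K) :=
  sInf {S | R ≤ S ∧ IsArf S}

/-- `c` is the conductor of the semigroup `S ⊆ ℕ²`: the least `δ` with `δ + ℕ² ⊆ S`. -/
def IsConductor (S : Set (ℕ × ℕ)) (c : ℕ × ℕ) : Prop :=
  IsLeast {δ : ℕ × ℕ | ∀ β, δ ≤ β → β ∈ S} c

/-- Remove from `φ` all terms of degree `> c[1] + 1` and from `ψ` all terms of degree
`> c[2] + 1`. -/
def truncate (c : ℕ × ℕ) (z : Ambient K) : Ambient K :=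
  ((PowerSeries.trunc (c.1 + 2) z.1 : Polynomial K),
    (PowerSeries.trunc (c.2 + 2) z.2 : Polynomial K))

/-! ### The blow-up algorithm and the multiplicity tree -/

/-- The non-units of a subalgebra `S`, i.e. its maximal ideal if `S` is local, as a subset of the
ambient ring. -/
def maxIdeal {A : Type*} [CommRing A] [Algebra K A] (S : Subalgebra K A) : Set A :=
  Subtype.val '' nonunits S

/-- The ring `[x⁻¹ S]`, generated by the quotients `z = r / x` with `r` in the maximal ideal
of `S`.  It is used for regular `x` of minimal valuation in the maximal ideal, so all these
quotients lie in the ambient ring; they include `1` and `x`, so the ring contains `S`. -/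
def blowUp {A : Type*} [CommRing A] [Algebra K A] (S : Subalgebra K A) (x : A) :
    Subalgebra K A :=
  Algebra.adjoin K {z | x * z ∈ maxIdeal S}

/-- `v` is the multiplicity vector of the local ring `S ⊆ K[[t]] × K[[u]]`. -/
def IsMult (S : Subalgebra K (Ambient K)) (v : ℕ × ℕ) : Prop :=
  IsLeast (val '' maxIdeal S) ((v.1 : ℕ∞), (v.2 : ℕ∞))

/-- `m` is the multiplicity of the local ring `S ⊆ K[[t]]`. -/
def IsBranchMult (S : Subalgebra K K⟦X⟧) (m : ℕ) : Prop :=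
  IsLeast (PowerSeries.order '' maxIdeal S) (m : ℕ∞)

/-- `S` is not local, being the product `S₁ × S₂` of local rings. -/
def SplitsAs (S : Subalgebra K (Ambient K)) (S₁ S₂ : Subalgebra K K⟦X⟧) : Prop :=
  S = S₁.prod S₂ ∧ IsLocalRing S₁ ∧ IsLocalRing S₂

/-- `mult*(S)`: it is `{mult(S)}` for `S` local, and `{(m₁, 0), (0, m₂)}` if `S = S₁ × S₂` with
local rings `Sᵢ` of multiplicity `mᵢ`. -/
def multStar (S : Subalgebra K (Ambient K)) : Set (ℕ × ℕ) :=
  {v | (IsLocalRing S ∧ IsMult S v) ∨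
    ∃ S₁ S₂, SplitsAs S S₁ S₂ ∧
      ((IsBranchMult S₁ v.1 ∧ v.2 = 0) ∨ (v.1 = 0 ∧ IsBranchMult S₂ v.2))}

/-- One step `S ↦ S'` of the algorithm.  The elements of minimal valuation by which one divides
may be chosen freely. -/
def Step (S S' : Subalgebra K (Ambient K)) : Prop :=
  (IsLocalRing S ∧ ∃ v, IsMult S v ∧ ∃ x ∈ maxIdeal S,
    val x = ((v.1 : ℕ∞), (v.2 : ℕ∞)) ∧ S' = blowUp S x) ∨
  ∃ S₁ S₂, SplitsAs S S₁ S₂ ∧ ∃ m₁ m₂, IsBranchMult S₁ m₁ ∧ IsBranchMult S₂ m₂ ∧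
    ∃ x₁ ∈ maxIdeal S₁, ∃ x₂ ∈ maxIdeal S₂, x₁.order = m₁ ∧ x₂.order = m₂ ∧
      S' = (blowUp S₁ x₁).prod (blowUp S₂ x₂)

/-- `ρ 1, …, ρ m` is the output of a complete run of the algorithm on `R`: starting with
`ρ 1 = R`, steps are performed as long as `mult*(ρ i) ≠ {(1, 0), (0, 1)}`, and the algorithm
halts at `ρ m`.  (Only the values of `ρ` at `1, …, m` matter.) -/
structure IsRun (R : Subalgebra K (Ambient K)) (m : ℕ) (ρ : ℕ → Subalgebra K (Ambient K)) :
    Prop where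
  one_le : 1 ≤ m
  start : ρ 1 = R
  step : ∀ i, 1 ≤ i → i < m → multStar (ρ i) ≠ {(1, 0), (0, 1)} ∧ Step (ρ i) (ρ (i + 1))
  halt : multStar (ρ m) = {(1, 0), (0, 1)}

/-- A tree whose nodes are vectors of `ℕ²` placed on levels: the pair `(i, v)` is the vector `v`
on level `i`. -/
@[ext]
structure LevelledTree where
  nodes : Set (ℕ × (ℕ × ℕ))
  linked : ℕ × (ℕ × ℕ) → ℕ × (ℕ × ℕ) → Prop

/-- The multiplicity tree built from a sequence `ρ 1, …, ρ m` of rings: the nodes on level `i` are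
the elements of `mult*(ρ i)`, and nodes on consecutive levels are linked if and only if their
scalar product is nonzero. -/
def multTree (m : ℕ) (ρ : ℕ → Subalgebra K (Ambient K)) : LevelledTree where
  nodes := {p | 1 ≤ p.1 ∧ p.1 ≤ m ∧ p.2 ∈ multStar (ρ p.1)}
  linked p q :=
    (1 ≤ p.1 ∧ p.1 ≤ m ∧ p.2 ∈ multStar (ρ p.1)) ∧
    (1 ≤ q.1 ∧ q.1 ≤ m ∧ q.2 ∈ multStar (ρ q.1)) ∧
    (q.1 = p.1 + 1 ∨ p.1 = q.1 + 1) ∧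
    p.2.1 * q.2.1 + p.2.2 * q.2.2 ≠ 0

end AlgebroidCurve

end

/-!
Divisibility in `A = K[[t]] × K[[u]]` is comparison of valuations, so "value at least `c`" means
"multiple of `tau c = (t ^ c[1], u ^ c[2])`", and dividing by an element of value `v` turns a
congruence modulo `tau (v + d)` into one modulo `tau d`.  The theorem comes down to two effects of
one blow-up of a local ring `S` of multiplicity `v`, obtained by dividing by `x ∈ S`.

* If `v ≤ c`, and `S` and `T` agree modulo `tau (c[1] + 2, c[2] + 2)`, then `T` has multiplicity `v`
  as well, and the blow-ups of `S` and `T` satisfy the same congruence with `c - v` in place of `c`,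
  whatever elements of minimal value one divides by
  (`IsMinimal.associated_of_congrMod`, `CongrMod.blowUp`).
* If all elements of value at least `c` lie in every Arf ring containing `S`, then `v ≤ c` and all
  elements of value at least `c - v` lie in every Arf ring containing the blow-up.  Indeed, for an
  Arf ring `B` containing the blow-up, `K + xB` is an Arf ring that contains `S`
  (`IsArfIn.constAdd`, `ArfContains.blowUp`).

Once the branches have separated, the same applies to each branch; there the bound `m ≤ c` on the
multiplicity can only fail for `m = 1`, and then the ring of the branch is all of `K[[t]]` and
nothing changes any more (`BranchStage.step`).

Starting with `R` and its truncation, which agree in degrees at most `c + 1`, and the conductor `c`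
of the Arf closure of `R`, the algorithm thus sees the same multiplicities for both rings at every
level (`Stage.step`), and it halts because the sum of the components of `c` decreases.

Topology enters as follows.  A closed subring of `A` contains the inverses of its elements that are
units of `A`, and it is local or a product of two local rings (`OrderClosed.invClosed`,
`OrderClosed.idempotent_mem`).  All rings that occur are closed: they contain `K[[x]]` for a regular
non-unit `x`, over which `A` is a finite module, so that Krull's intersection theorem applies
(`orderClosed_of_range_le`).  Finiteness also provides a common denominator for the fractions
representing the elements of `A`, whence the existence of the conductor (`exists_isConductor`).
-/

noncomputable section

namespace AlgebroidCurve

/-! ### Subalgebras up to a congruence and their blow-ups -/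

section Generic

variable {K : Type*} [Field K] {A : Type*} [CommRing A] [Algebra K A]

/-- The Arf condition in an arbitrary ambient ring: for regular `x ∈ S`, the elements `r / x` with
`r ∈ S` form a ring. Since the valuations of the ambient ring are not mentioned, the condition
makes sense both for one branch and for two. -/
def IsArfIn (S : Subalgebra K A) : Prop :=
  ∀ x ∈ S, x ∈ nonZeroDivisors A → ∃ T : Subring A, (T : Set A) = {z | x * z ∈ S}

theorem isArfIn_top : IsArfIn (⊤ : Subalgebra K A) :=
  fun _ _ _ => ⟨⊤, by ext; simp⟩

/-- The subalgebra `S + gA`. -/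
def thicken (g : A) (S : Subalgebra K A) : Subalgebra K A where
  carrier := {z | ∃ s ∈ S, g ∣ z - s}
  mul_mem' := by
    rintro a b ⟨s, hs, h⟩ ⟨t, ht, h'⟩
    refine ⟨s * t, mul_mem hs ht, ?_⟩
    have e : a * b - s * t = (a - s) * b + s * (b - t) := by ring
    rw [e]
    exact dvd_add (h.mul_right _) (h'.mul_left _)
  add_mem' := by
    rintro a b ⟨s, hs, h⟩ ⟨t, ht, h'⟩
    refine ⟨s + t, add_mem hs ht, ?_⟩
    have e : a + b - (s + t) = (a - s) + (b - t) := by ring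
    rw [e]
    exact dvd_add h h'
  algebraMap_mem' r := ⟨algebraMap K A r, Subalgebra.algebraMap_mem _ r, by simp⟩

theorem mem_thicken {g : A} {S : Subalgebra K A} {z : A} :
    z ∈ thicken g S ↔ ∃ s ∈ S, g ∣ z - s := Iff.rfl

theorem le_thicken (g : A) (S : Subalgebra K A) : S ≤ thicken g S :=
  fun s hs => ⟨s, hs, by simp⟩

/-- `S` and `T` agree modulo the ideal generated by `g`. -/
def CongrMod (g : A) (S T : Subalgebra K A) : Prop :=
  S ≤ thicken g T ∧ T ≤ thicken g S

theorem CongrMod.symm {g : A} {S T : Subalgebra K A} (h : CongrMod g S T) : CongrMod g T S :=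
  ⟨h.2, h.1⟩

/-- Elements of `S` that are invertible in the ambient ring are invertible in `S`. -/
def InvClosed (S : Subalgebra K A) : Prop :=
  ∀ s ∈ S, ∀ t, s * t = 1 → t ∈ S

/-- Every element of `S` is a constant modulo the Jacobson radical of the ambient ring. -/
def ResidueConstant (S : Subalgebra K A) : Prop :=
  ∀ s ∈ S, ∃ k : K, s - algebraMap K A k ∈ Ideal.jacobson (⊥ : Ideal A)

/-- `x` is a regular element of `S` in the Jacobson radical of the ambient ring, and divides all
elements of `S` in this radical. Since divisibility in the rings of power series is comparison
of valuations, these are the elements of minimal valuation. -/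
structure IsMinimal (S : Subalgebra K A) (x : A) : Prop where
  mem : x ∈ S
  mem_jacobson : x ∈ Ideal.jacobson (⊥ : Ideal A)
  regular : x ∈ nonZeroDivisors A
  dvd : ∀ r ∈ S, r ∈ Ideal.jacobson (⊥ : Ideal A) → x ∣ r

theorem isUnit_add_of_mem_jacobson {u j : A} (hu : IsUnit u)
    (hj : j ∈ Ideal.jacobson (⊥ : Ideal A)) : IsUnit (u + j) := by
  obtain ⟨u, rfl⟩ := hu
  have h := Ideal.mem_jacobson_bot.1 hj (↑u⁻¹ : A)
  have e : (u : A) + j = u * (j * ↑u⁻¹ + 1) := by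
    rw [mul_add, mul_one, mul_comm j, ← mul_assoc, Units.mul_inv, one_mul, add_comm]
  rw [e]
  exact u.isUnit.mul h

theorem isUnit_algebraMap {k : K} (hk : k ≠ 0) : IsUnit (algebraMap K A k) :=
  (IsUnit.mk0 k hk).map _

theorem not_isUnit_of_mem_jacobson [Nontrivial A] {j : A}
    (hj : j ∈ Ideal.jacobson (⊥ : Ideal A)) : ¬ IsUnit j := by
  rintro ⟨u, rfl⟩
  have h := Ideal.mem_jacobson_bot.1 hj (-(↑u⁻¹ : A))
  simp at h

/-- A constant that lies in the Jacobson radical up to the radical is zero. -/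
theorem eq_zero_of_add_mem_jacobson [Nontrivial A] {k : K} {j : A}
    (hj : j ∈ Ideal.jacobson (⊥ : Ideal A))
    (h : algebraMap K A k + j ∈ Ideal.jacobson (⊥ : Ideal A)) : k = 0 := by
  by_contra hk
  have h1 := (Ideal.jacobson (⊥ : Ideal A)).sub_mem h hj
  rw [add_sub_cancel_right] at h1
  exact not_isUnit_of_mem_jacobson h1 (isUnit_algebraMap hk)

theorem InvClosed.isUnit_iff {S : Subalgebra K A} (hS : InvClosed S) (s : S) :
    IsUnit s ↔ IsUnit (s : A) := by
  refine ⟨fun h => h.map S.val, fun h => ?_⟩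
  obtain ⟨t, ht⟩ := h.exists_right_inv
  exact IsUnit.of_mul_eq_one ⟨t, hS s s.2 t ht⟩ (Subtype.ext ht)

section Local

variable {S T : Subalgebra K A}

theorem ResidueConstant.mem_jacobson_of_not_isUnit (hc : ResidueConstant S) {s : A} (hs : s ∈ S)
    (h : ¬ IsUnit s) : s ∈ Ideal.jacobson (⊥ : Ideal A) := by
  obtain ⟨k, hk⟩ := hc s hs
  by_cases h0 : k = 0
  · simpa [h0] using hk
  · refine absurd ?_ h
    have := isUnit_add_of_mem_jacobson (isUnit_algebraMap (A := A) h0) hk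
    simpa using this

theorem mem_maxIdeal_iff [Nontrivial A] (hi : InvClosed S) (hc : ResidueConstant S) {s : A} :
    s ∈ maxIdeal S ↔ s ∈ S ∧ s ∈ Ideal.jacobson (⊥ : Ideal A) := by
  constructor
  · rintro ⟨⟨s, hs⟩, hn, rfl⟩
    refine ⟨hs, hc.mem_jacobson_of_not_isUnit hs fun h => hn ?_⟩
    exact (hi.isUnit_iff _).2 h
  · rintro ⟨hs, hj⟩
    exact ⟨⟨s, hs⟩, fun h => not_isUnit_of_mem_jacobson hj ((hi.isUnit_iff _).1 h), rfl⟩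

theorem isLocalRing_of_residueConstant [Nontrivial A] (hi : InvClosed S) (hc : ResidueConstant S) :
    IsLocalRing S := by
  refine IsLocalRing.of_nonunits_add fun a b ha hb h => ?_
  have hj : ∀ a : S, a ∈ nonunits S → (a : A) ∈ Ideal.jacobson (⊥ : Ideal A) := fun a ha =>
    hc.mem_jacobson_of_not_isUnit a.2 fun h => ha ((hi.isUnit_iff _).2 h)
  exact not_isUnit_of_mem_jacobson (Ideal.add_mem _ (hj a ha) (hj b hb)) (h.map S.val)

theorem ResidueConstant.of_congrMod {g : A} (hg : g ∈ Ideal.jacobson (⊥ : Ideal A))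
    (h : CongrMod g S T) (hc : ResidueConstant S) : ResidueConstant T := by
  intro t ht
  obtain ⟨s, hs, hd⟩ := h.2 ht
  obtain ⟨k, hk⟩ := hc s hs
  refine ⟨k, ?_⟩
  have := Ideal.add_mem _ (Ideal.mem_of_dvd _ hd hg) hk
  simpa using this

theorem le_blowUp [Nontrivial A] {x : A} (hi : InvClosed S)
    (hc : ResidueConstant S) (hx : IsMinimal S x) :
    S ≤ blowUp S x := by
  have hxm : x ∈ blowUp S x := by
    refine Algebra.subset_adjoin ((mem_maxIdeal_iff hi hc).2 ⟨mul_mem hx.mem hx.mem, ?_⟩)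
    exact Ideal.mul_mem_left _ _ hx.mem_jacobson
  intro s hs
  obtain ⟨k, hk⟩ := hc s hs
  have hm : s - algebraMap K A k ∈ S := sub_mem hs (S.algebraMap_mem k)
  obtain ⟨z, hz⟩ := hx.dvd _ hm hk
  have hzm : z ∈ blowUp S x := by
    refine Algebra.subset_adjoin ((mem_maxIdeal_iff hi hc).2 ?_)
    rw [← hz]; exact ⟨hm, hk⟩
  have : s = x * z + algebraMap K A k := by rw [← hz]; ring
  rw [this]
  exact add_mem (mul_mem hxm hzm) (Subalgebra.algebraMap_mem _ k)

/-- If `S` and `T` agree modulo a proper multiple of an element of minimal value of `S`, then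
the elements of minimal value of `T` have the same value. -/
theorem IsMinimal.associated_of_congrMod {g g' x y : A} (h : CongrMod g S T)
    (hx : IsMinimal S x) (hg' : g' ∈ Ideal.jacobson (⊥ : Ideal A)) (hg : x * g' ∣ g)
    (hy : IsMinimal T y) : Associated x y := by
  have hxg : x ∣ g := (dvd_mul_right _ _).trans hg
  have hgj : g ∈ Ideal.jacobson (⊥ : Ideal A) := Ideal.mem_of_dvd _ hxg hx.mem_jacobson
  have hxy : x ∣ y := by
    obtain ⟨s, hs, hd⟩ := h.2 hy.mem
    have hsj : s ∈ Ideal.jacobson (⊥ : Ideal A) := by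
      have := Ideal.sub_mem _ hy.mem_jacobson (Ideal.mem_of_dvd _ hd hgj)
      simpa using this
    have := dvd_add (hxg.trans hd) (hx.dvd s hs hsj)
    simpa using this
  have hyx : y ∣ x := by
    obtain ⟨t, ht, hd⟩ := h.1 hx.mem
    obtain ⟨a, ha⟩ := hg.trans hd
    -- an element of `T` close to `x` is `x` times a unit
    have htx : t = x * (1 + -(g' * a)) := by
      linear_combination -ha
    have hu : IsUnit (1 + -(g' * a)) := isUnit_add_of_mem_jacobson isUnit_one
      (Ideal.neg_mem_iff _ |>.2 (Ideal.mul_mem_right _ _ hg'))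
    have htj : t ∈ Ideal.jacobson (⊥ : Ideal A) := by
      rw [htx]; exact Ideal.mul_mem_right _ _ hx.mem_jacobson
    have := hy.dvd t ht htj
    rw [htx] at this
    exact hu.dvd_mul_right.1 this
  obtain ⟨u, hu⟩ := hxy
  obtain ⟨w, hw⟩ := hyx
  have : x * (u * w) = x * 1 := by rw [← mul_assoc, ← hu, ← hw, mul_one]
  have huw := (mul_cancel_left_mem_nonZeroDivisors hx.regular).1 this
  exact ⟨⟨u, w, huw, by rw [mul_comm, huw]⟩, hu.symm⟩

/-- For `r ∈ S` and `r' ∈ T` close to `r`, and `x ∈ S` and `x' ∈ T` close to `x`, the quotients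
`r / x` and `r' / x'` are close. -/
theorem blowUp_le_thicken [Nontrivial A] {g g' x y : A} (h : CongrMod g S T) (hSi : InvClosed S)
    (hSc : ResidueConstant S) (hTi : InvClosed T) (hTc : ResidueConstant T)
    (hTi' : InvClosed (blowUp T y)) (hx : IsMinimal S x) (hy : IsMinimal T y)
    (hg' : g' ∈ Ideal.jacobson (⊥ : Ideal A)) (hg : x * g' ∣ g) :
    blowUp S x ≤ thicken g' (blowUp T y) := by
  have hxg : x ∣ g := (dvd_mul_right _ _).trans hg
  have hgj : g ∈ Ideal.jacobson (⊥ : Ideal A) := Ideal.mem_of_dvd _ hxg hx.mem_jacobson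
  have hlift : ∀ r ∈ S, r ∈ Ideal.jacobson (⊥ : Ideal A) →
      ∃ z ∈ blowUp T y, g ∣ r - y * z := by
    intro r hr hrj
    obtain ⟨t, ht, hd⟩ := h.1 hr
    have htj : t ∈ Ideal.jacobson (⊥ : Ideal A) := by
      have := Ideal.sub_mem _ hrj (Ideal.mem_of_dvd _ hd hgj)
      simpa using this
    obtain ⟨z, rfl⟩ := hy.dvd t ht htj
    exact ⟨z, Algebra.subset_adjoin ((mem_maxIdeal_iff hTi hTc).2 ⟨ht, htj⟩), hd⟩
  obtain ⟨v, hv⟩ := hx.associated_of_congrMod h hg' hg hy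
  obtain ⟨u, hu, hxu⟩ := hlift x hx.mem hx.mem_jacobson
  -- `y * u` is an element of `T` close to `x`, hence associated to `x` and `y`
  have huu : IsUnit (↑v * u) := by
    obtain ⟨a, ha⟩ := hg.trans hxu
    have e : x * (↑v * u) = x * (1 + -(g' * a)) := by
      rw [← mul_assoc, hv]; linear_combination -ha
    rw [(mul_cancel_left_mem_nonZeroDivisors hx.regular).1 e]
    exact isUnit_add_of_mem_jacobson isUnit_one
      (Ideal.neg_mem_iff _ |>.2 (Ideal.mul_mem_right _ _ hg'))
  obtain ⟨w, hw⟩ := (isUnit_of_mul_isUnit_right huu).exists_right_inv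
  have hwm : w ∈ blowUp T y := hTi' u hu w hw
  refine Algebra.adjoin_le fun z hz => ?_
  obtain ⟨hzS, hzj⟩ := (mem_maxIdeal_iff hSi hSc).1 hz
  obtain ⟨z', hz', hzd⟩ := hlift _ hzS hzj
  refine ⟨z' * w, mul_mem hz' hwm, ?_⟩
  have h1 : x * g ∣ x * (y * u * (z - z' * w)) := by
    have e : x * (y * u * (z - z' * w)) =
        -(x * z * (x - y * u)) + x * (x * z - y * z') := by
      linear_combination (-(x * y * z')) * hw
    rw [e]
    refine dvd_add ?_ (mul_dvd_mul_left _ hzd)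
    rw [dvd_neg, mul_assoc]
    exact mul_dvd_mul_left _ (hxu.mul_left _)
  have h2 : g ∣ y * u * (z - z' * w) := by
    obtain ⟨a, ha⟩ := h1
    refine ⟨a, ?_⟩
    rw [mul_assoc x] at ha
    exact (mul_cancel_left_mem_nonZeroDivisors hx.regular).1 ha
  have h3 : x * g' ∣ x * (↑v * u * (z - z' * w)) := by
    have e : x * (↑v * u * (z - z' * w)) = y * u * (z - z' * w) := by rw [← hv]; ring
    rw [e]
    exact hg.trans h2
  obtain ⟨a, ha⟩ := h3
  rw [mul_assoc x] at ha
  have h4 := (mul_cancel_left_mem_nonZeroDivisors hx.regular).1 ha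
  exact huu.dvd_mul_left.1 ⟨a, h4⟩

/-- Blowing up divides the modulus of a congruence by the multiplicity. -/
theorem CongrMod.blowUp [Nontrivial A] {g g' x y : A} (h : CongrMod g S T) (hSi : InvClosed S)
    (hSc : ResidueConstant S) (hTi : InvClosed T)
    (hSi' : InvClosed (blowUp S x)) (hTi' : InvClosed (blowUp T y))
    (hx : IsMinimal S x) (hy : IsMinimal T y)
    (hg' : g' ∈ Ideal.jacobson (⊥ : Ideal A)) (hg : x * g' ∣ g) :
    CongrMod g' (blowUp S x) (blowUp T y) := by
  have hgj : g ∈ Ideal.jacobson (⊥ : Ideal A) :=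
    Ideal.mem_of_dvd _ ((dvd_mul_right _ _).trans hg) hx.mem_jacobson
  have hTc := hSc.of_congrMod hgj h
  have hxy := hx.associated_of_congrMod h hg' hg hy
  exact ⟨blowUp_le_thicken h hSi hSc hTi hTc hTi' hx hy hg' hg,
    blowUp_le_thicken h.symm hTi hTc hSi hSc hSi' hy hx hg'
      ((mul_dvd_mul_right hxy.symm.dvd g').trans hg)⟩

/-- The ring `K + xB`, for `x ∈ B`. -/
def constAdd (B : Subalgebra K A) (x : A) (hx : x ∈ B) : Subalgebra K A where
  carrier := {z | ∃ k : K, ∃ b ∈ B, z = algebraMap K A k + x * b}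
  mul_mem' := by
    rintro _ _ ⟨k, b, hb, rfl⟩ ⟨l, c, hc, rfl⟩
    refine ⟨k * l, algebraMap K A k * c + algebraMap K A l * b + x * (b * c), ?_, ?_⟩
    · exact add_mem (add_mem (mul_mem (B.algebraMap_mem _) hc) (mul_mem (B.algebraMap_mem _) hb))
        (mul_mem hx (mul_mem hb hc))
    · rw [map_mul]; ring
  add_mem' := by
    rintro _ _ ⟨k, b, hb, rfl⟩ ⟨l, c, hc, rfl⟩
    exact ⟨k + l, b + c, add_mem hb hc, by rw [map_add]; ring⟩
  algebraMap_mem' r := ⟨r, 0, zero_mem _, by simp⟩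

theorem mem_constAdd {B : Subalgebra K A} {x : A} {hx : x ∈ B} {z : A} :
    z ∈ constAdd B x hx ↔ ∃ k : K, ∃ b ∈ B, z = algebraMap K A k + x * b := Iff.rfl

/-- If `B` is an Arf ring, then so is `K + xB`: for an element `xb` the quotient ring is the one
of `B` at `b`, and the other regular elements are units. -/
theorem IsArfIn.constAdd [Nontrivial A] {B : Subalgebra K A} (hB : IsArfIn B)
    (hi : InvClosed B) {x : A} (hx : x ∈ B) (hxr : x ∈ nonZeroDivisors A)
    (hxj : x ∈ Ideal.jacobson (⊥ : Ideal A)) :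
    IsArfIn (constAdd B x hx) := by
  rintro _ ⟨k, b, hb, rfl⟩ hr
  have hj : ∀ b, x * b ∈ Ideal.jacobson (⊥ : Ideal A) := fun b => Ideal.mul_mem_right _ _ hxj
  by_cases hk : k = 0
  · subst hk
    rw [map_zero, zero_add] at hr ⊢
    obtain ⟨T, hT⟩ := hB b hb (mul_mem_nonZeroDivisors.1 hr).2
    refine ⟨T, hT.trans (Set.ext fun z => ?_)⟩
    simp only [Set.mem_ofPred_eq, mem_constAdd]
    constructor
    · intro h
      exact ⟨0, b * z, h, by rw [map_zero]; ring⟩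
    · rintro ⟨l, c, hc, he⟩
      have hl : l = 0 := by
        refine eq_zero_of_add_mem_jacobson (hj c) ?_
        rw [← he, mul_assoc]; exact hj _
      rw [hl, map_zero, zero_add, mul_assoc] at he
      rwa [(mul_cancel_left_mem_nonZeroDivisors hxr).1 he]
  · obtain ⟨w, hw⟩ :=
      (isUnit_add_of_mem_jacobson (isUnit_algebraMap (A := A) hk) (hj b)).exists_right_inv
    have hwB : w ∈ B := hi _ (add_mem (B.algebraMap_mem _) (mul_mem hx hb)) w hw
    have hkk : algebraMap K A k⁻¹ * algebraMap K A k = 1 := by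
      rw [← map_mul, inv_mul_cancel₀ hk, map_one]
    have hwm : w ∈ AlgebroidCurve.constAdd B x hx := by
      refine ⟨k⁻¹, -(algebraMap K A k⁻¹ * b * w),
        neg_mem (mul_mem (mul_mem (B.algebraMap_mem _) hb) hwB), ?_⟩
      linear_combination (algebraMap K A k⁻¹) * hw - w * hkk
    refine ⟨(AlgebroidCurve.constAdd B x hx).toSubring, Set.ext fun z => ?_⟩
    constructor
    · intro hz
      have hr : algebraMap K A k + x * b ∈ AlgebroidCurve.constAdd B x hx := ⟨k, b, hb, rfl⟩
      exact mul_mem hr hz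
    · intro hz
      have := mul_mem hwm hz
      rwa [← mul_assoc, mul_comm w, hw, one_mul] at this

theorem le_constAdd [Nontrivial A] {B : Subalgebra K A} {x : A} (hi : InvClosed S)
    (hc : ResidueConstant S) (hx : IsMinimal S x) (hB : blowUp S x ≤ B) :
    S ≤ constAdd B x (hB (le_blowUp hi hc hx hx.mem)) := by
  intro s hs
  obtain ⟨k, hk⟩ := hc s hs
  have hm : s - algebraMap K A k ∈ S := sub_mem hs (S.algebraMap_mem k)
  obtain ⟨z, hz⟩ := hx.dvd _ hm hk
  refine ⟨k, z, hB (Algebra.subset_adjoin ((mem_maxIdeal_iff hi hc).2 ?_)), ?_⟩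
  · rw [← hz]; exact ⟨hm, hk⟩
  · rw [← hz]; ring

/-- Every Arf ring containing `S` contains the ideal generated by `g`. -/
def ArfContains (S : Subalgebra K A) (g : A) : Prop :=
  ∀ B, S ≤ B → IsArfIn B → ∀ z, g ∣ z → z ∈ B

/-- The effect of a blow-up on conductors: they are divided by the multiplicity. -/
theorem ArfContains.blowUp [Nontrivial A] {g x : A} (h : ArfContains S g)
    (hi : ∀ B, S ≤ B → InvClosed B) (hc : ResidueConstant S) (hx : IsMinimal S x)
    (hg : g ∈ Ideal.jacobson (⊥ : Ideal A)) :
    x ∣ g ∧ ∀ g', g ∣ x * g' → ArfContains (blowUp S x) g' := by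
  have hle := le_blowUp (hi S le_rfl) hc hx
  have key : ∀ B, AlgebroidCurve.blowUp S x ≤ B → IsArfIn B → ∀ z, g ∣ z →
      ∃ b ∈ B, z = x * b := by
    intro B hB hA z hz
    obtain ⟨k, b, hb, rfl⟩ := h _ (le_constAdd (hi S le_rfl) hc hx hB)
      (hA.constAdd (hi B (hle.trans hB)) _ hx.regular hx.mem_jacobson) z hz
    have hk : k = 0 := eq_zero_of_add_mem_jacobson (Ideal.mul_mem_right _ _ hx.mem_jacobson)
      (Ideal.mem_of_dvd _ hz hg)
    exact ⟨b, hb, by rw [hk, map_zero, zero_add]⟩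
  constructor
  · obtain ⟨b, -, hb⟩ := key ⊤ le_top isArfIn_top g dvd_rfl
    exact ⟨b, hb⟩
  · intro g' hg' B hB hA z hz
    obtain ⟨b, hb, he⟩ := key B hB hA (x * z) (hg'.trans (mul_dvd_mul_left _ hz))
    rwa [(mul_cancel_left_mem_nonZeroDivisors hx.regular).1 he]

end Local

end Generic

/-! ### Divisibility and valuations in rings of power series -/

section PowerSeriesFacts

variable {K : Type*} [Field K]

theorem dvd_iff_order_le {f g : K⟦X⟧} : f ∣ g ↔ f.order ≤ g.order := by
  constructor
  · rintro ⟨h, rfl⟩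
    rw [PowerSeries.order_mul]; exact le_self_add
  · intro h
    by_cases hg : g = 0
    · rw [hg]; exact dvd_zero _
    have hf : f ≠ 0 := by
      rintro rfl
      rw [PowerSeries.order_zero, top_le_iff, PowerSeries.order_eq_top] at h
      exact hg h
    have h1 : g.order.toNat = g.order := PowerSeries.coe_toNat_order hg
    have h2 : f.order.toNat = f.order := PowerSeries.coe_toNat_order hf
    have h3 : f ∣ PowerSeries.X ^ f.order.toNat := by
      obtain ⟨u, hu⟩ := PowerSeries.isUnit_divided_by_X_pow_order hf
      have := PowerSeries.X_pow_order_mul_divXPowOrder (f := f)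
      rw [← hu] at this
      exact ⟨_, (Units.eq_mul_inv_iff_mul_eq u).2 this⟩
    refine h3.trans ((pow_dvd_pow _ ?_).trans PowerSeries.X_pow_order_dvd)
    rw [← h1, ← h2] at h
    exact_mod_cast h

theorem X_pow_dvd_iff_le_order {f : K⟦X⟧} {n : ℕ} :
    PowerSeries.X ^ n ∣ f ↔ (n : ℕ∞) ≤ f.order := by
  rw [dvd_iff_order_le, PowerSeries.order_X_pow]

theorem mem_jacobson_iff {f : K⟦X⟧} :
    f ∈ Ideal.jacobson (⊥ : Ideal K⟦X⟧) ↔ PowerSeries.X ∣ f := by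
  rw [IsLocalRing.jacobson_eq_maximalIdeal _ bot_ne_top, PowerSeries.maximalIdeal_eq_span_X,
    Ideal.mem_span_singleton]

theorem mem_jacobson_prod_iff {z : Ambient K} :
    z ∈ Ideal.jacobson (⊥ : Ideal (Ambient K)) ↔ PowerSeries.X ∣ z.1 ∧ PowerSeries.X ∣ z.2 := by
  rw [← mem_jacobson_iff, ← mem_jacobson_iff, Ideal.mem_jacobson_bot, Ideal.mem_jacobson_bot,
    Ideal.mem_jacobson_bot]
  constructor
  · intro h
    exact ⟨fun y => (Prod.isUnit_iff.1 (h (y, 0))).1, fun y => (Prod.isUnit_iff.1 (h (0, y))).2⟩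
  · rintro ⟨h1, h2⟩ y
    exact Prod.isUnit_iff.2 ⟨h1 _, h2 _⟩

theorem mem_nonZeroDivisors_prod_iff {z : Ambient K} :
    z ∈ nonZeroDivisors (Ambient K) ↔ z.1 ≠ 0 ∧ z.2 ≠ 0 := by
  rw [mem_nonZeroDivisors_iff_right]
  constructor
  · intro h
    constructor
    · intro h1
      have := congrArg Prod.fst (h (1, 0) (by ext1 <;> simp [h1]))
      simp at this
    · intro h1
      have := congrArg Prod.snd (h (0, 1) (by ext1 <;> simp [h1]))
      simp at this
  · rintro ⟨h1, h2⟩ w hw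
    have e1 := congrArg Prod.fst hw
    have e2 := congrArg Prod.snd hw
    simp only [Prod.fst_mul, Prod.snd_mul, Prod.fst_zero, Prod.snd_zero, mul_eq_zero, h1, h2,
      or_false] at e1 e2
    exact Prod.ext e1 e2

theorem val_le_val_iff {x z : Ambient K} : val x ≤ val z ↔ x ∣ z := by
  rw [prod_dvd_iff, dvd_iff_order_le, dvd_iff_order_le]; rfl

theorem isArf_iff {S : Subalgebra K (Ambient K)} : IsArf S ↔ IsArfIn S := by
  have e : ∀ x, {z | ∃ r ∈ S, val x ≤ val r ∧ x * z = r} = {z | x * z ∈ S} := by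
    intro x
    ext z
    refine ⟨fun ⟨r, hr, _, he⟩ => ?_, fun h => ⟨_, h, val_le_val_iff.2 (dvd_mul_right _ _), rfl⟩⟩
    rw [← he] at hr
    exact hr
  simp only [IsArf, IsArfIn, mem_nonZeroDivisors_prod_iff, e, and_imp]

/-- The element `(t ^ c[1], u ^ c[2])`, whose multiples are the elements of value at least `c`. -/
def tau (c : ℕ × ℕ) : Ambient K := (PowerSeries.X ^ c.1, PowerSeries.X ^ c.2)

theorem tau_dvd_iff {c : ℕ × ℕ} {z : Ambient K} :
    tau c ∣ z ↔ PowerSeries.X ^ c.1 ∣ z.1 ∧ PowerSeries.X ^ c.2 ∣ z.2 := prod_dvd_iff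

theorem tau_dvd_iff_le_val {c : ℕ × ℕ} {z : Ambient K} :
    tau c ∣ z ↔ ((c.1 : ℕ∞), (c.2 : ℕ∞)) ≤ val z := by
  rw [tau_dvd_iff, X_pow_dvd_iff_le_order, X_pow_dvd_iff_le_order]; rfl

theorem tau_add (c d : ℕ × ℕ) : (tau (c + d) : Ambient K) = tau c * tau d := by
  ext1 <;> simp [tau, pow_add]

theorem tau_dvd_tau {c d : ℕ × ℕ} (h : c ≤ d) : (tau c : Ambient K) ∣ tau d :=
  tau_dvd_iff.2 ⟨pow_dvd_pow _ h.1, pow_dvd_pow _ h.2⟩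

theorem tau_mem_jacobson {c : ℕ × ℕ} (h1 : c.1 ≠ 0) (h2 : c.2 ≠ 0) :
    (tau c : Ambient K) ∈ Ideal.jacobson (⊥ : Ideal (Ambient K)) :=
  mem_jacobson_prod_iff.2 ⟨dvd_pow_self _ h1, dvd_pow_self _ h2⟩

/-- The valuation vector of a regular element, in `ℕ²`. For other elements, infinite components
are replaced by `0`. -/
def natVal (x : Ambient K) : ℕ × ℕ := (x.1.order.toNat, x.2.order.toNat)

theorem val_eq_natVal {x : Ambient K} (hx : x ∈ nonZeroDivisors (Ambient K)) :
    val x = (((natVal x).1 : ℕ∞), ((natVal x).2 : ℕ∞)) := by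
  obtain ⟨h1, h2⟩ := mem_nonZeroDivisors_prod_iff.1 hx
  exact Prod.ext (PowerSeries.coe_toNat_order h1).symm (PowerSeries.coe_toNat_order h2).symm

theorem dvd_tau_natVal {x : Ambient K} (hx : x ∈ nonZeroDivisors (Ambient K)) :
    x ∣ tau (natVal x) := by
  rw [← val_le_val_iff, val_eq_natVal hx]
  exact tau_dvd_iff_le_val.1 dvd_rfl

theorem tau_natVal_dvd {x : Ambient K} (hx : x ∈ nonZeroDivisors (Ambient K)) :
    tau (natVal x) ∣ x := by
  rw [tau_dvd_iff_le_val, val_eq_natVal hx]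

theorem tau_pow (c : ℕ × ℕ) (i : ℕ) : (tau c : Ambient K) ^ i = tau (c.1 * i, c.2 * i) := by
  ext1 <;> simp [tau, pow_mul]

theorem exists_dvd_tau {x : Ambient K} (hx : x ∈ nonZeroDivisors (Ambient K)) (i : ℕ) :
    ∃ N, x ^ i ∣ tau (N, N) := by
  refine ⟨max (natVal x).1 (natVal x).2 * i, ?_⟩
  refine (pow_dvd_pow_of_dvd (dvd_tau_natVal hx) i).trans ?_
  rw [tau_pow]
  exact tau_dvd_tau ⟨Nat.mul_le_mul_right _ (le_max_left _ _),
    Nat.mul_le_mul_right _ (le_max_right _ _)⟩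

theorem isMult_iff {S : Subalgebra K (Ambient K)} (hi : InvClosed S) (hc : ResidueConstant S)
    {x : Ambient K} (hx : IsMinimal S x) {v : ℕ × ℕ} :
    IsMult S v ↔ val x = ((v.1 : ℕ∞), (v.2 : ℕ∞)) := by
  have h : IsLeast (val '' maxIdeal S) (val x) := by
    refine ⟨⟨x, (mem_maxIdeal_iff hi hc).2 ⟨hx.mem, hx.mem_jacobson⟩, rfl⟩, ?_⟩
    rintro _ ⟨r, hr, rfl⟩
    obtain ⟨h1, h2⟩ := (mem_maxIdeal_iff hi hc).1 hr
    exact val_le_val_iff.2 (hx.dvd r h1 h2)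
  exact ⟨fun h' => h.unique h', fun e => by rw [e] at h; exact h⟩

theorem isBranchMult_iff {S : Subalgebra K K⟦X⟧} (hi : InvClosed S) (hc : ResidueConstant S)
    {x : K⟦X⟧} (hx : IsMinimal S x) {m : ℕ} :
    IsBranchMult S m ↔ x.order = m := by
  have h : IsLeast (PowerSeries.order '' maxIdeal S) x.order := by
    refine ⟨⟨x, (mem_maxIdeal_iff hi hc).2 ⟨hx.mem, hx.mem_jacobson⟩, rfl⟩, ?_⟩
    rintro _ ⟨r, hr, rfl⟩
    obtain ⟨h1, h2⟩ := (mem_maxIdeal_iff hi hc).1 hr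
    exact dvd_iff_order_le.1 (hx.dvd r h1 h2)
  exact ⟨fun h' => h.unique h', fun e => by rw [e] at h; exact h⟩

/-- The minimal orders in the two components are attained simultaneously, if necessary at the sum
of an element attaining the first one and an element attaining the second one. -/
theorem exists_isMinimal {S : Subalgebra K (Ambient K)} {x₀ : Ambient K} (hx₀ : x₀ ∈ S)
    (hr : x₀ ∈ nonZeroDivisors (Ambient K)) (hj : x₀ ∈ Ideal.jacobson (⊥ : Ideal (Ambient K))) :
    ∃ x, IsMinimal S x := by
  set J := {r | r ∈ S ∧ r ∈ Ideal.jacobson (⊥ : Ideal (Ambient K))} with hJ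
  have h0 : x₀ ∈ J := ⟨hx₀, hj⟩
  obtain ⟨a, haJ, ha⟩ := exists_minimalFor_of_wellFoundedLT (· ∈ J) (fun r => r.1.order) ⟨x₀, h0⟩
  obtain ⟨b, hbJ, hb⟩ := exists_minimalFor_of_wellFoundedLT (· ∈ J) (fun r => r.2.order) ⟨x₀, h0⟩
  have ha' : ∀ r ∈ J, a.1.order ≤ r.1.order := fun r hr' =>
    (le_total a.1.order r.1.order).elim id (ha hr')
  have hb' : ∀ r ∈ J, b.2.order ≤ r.2.order := fun r hr' =>
    (le_total b.2.order r.2.order).elim id (hb hr')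
  have key : ∀ x ∈ J, x.1.order ≤ a.1.order → x.2.order ≤ b.2.order → IsMinimal S x := by
    intro x hx h1 h2
    have hd : ∀ r ∈ J, x ∣ r := fun r hr' =>
      val_le_val_iff.1 ⟨h1.trans (ha' r hr'), h2.trans (hb' r hr')⟩
    refine ⟨hx.1, hx.2, ?_, fun r h h' => hd r ⟨h, h'⟩⟩
    obtain ⟨w, hw⟩ := hd x₀ h0
    rw [hw] at hr
    exact (mul_mem_nonZeroDivisors.1 hr).1
  by_cases h1 : b.1.order ≤ a.1.order
  · exact ⟨b, key b hbJ h1 le_rfl⟩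
  by_cases h2 : a.2.order ≤ b.2.order
  · exact ⟨a, key a haJ le_rfl h2⟩
  push Not at h1 h2
  refine ⟨a + b, key _ ⟨add_mem haJ.1 hbJ.1, add_mem haJ.2 hbJ.2⟩ ?_ ?_⟩
  · rw [Prod.fst_add, PowerSeries.order_add_of_order_ne _ _ h1.ne]
    exact inf_le_left
  · rw [Prod.snd_add, PowerSeries.order_add_of_order_ne _ _ h2.ne']
    exact inf_le_right

theorem exists_isMinimal_branch {S : Subalgebra K K⟦X⟧} {x₀ : K⟦X⟧} (hx₀ : x₀ ∈ S)
    (hr : x₀ ≠ 0) (hj : x₀ ∈ Ideal.jacobson (⊥ : Ideal K⟦X⟧)) : ∃ x, IsMinimal S x := by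
  obtain ⟨a, haJ, ha⟩ := exists_minimalFor_of_wellFoundedLT
    (fun r => r ∈ S ∧ r ∈ Ideal.jacobson (⊥ : Ideal K⟦X⟧)) PowerSeries.order ⟨x₀, hx₀, hj⟩
  have hd : ∀ r ∈ S, r ∈ Ideal.jacobson (⊥ : Ideal K⟦X⟧) → a ∣ r := fun r h h' =>
    dvd_iff_order_le.2 ((le_total a.order r.order).elim id (ha ⟨h, h'⟩))
  refine ⟨a, haJ.1, haJ.2, mem_nonZeroDivisors_of_ne_zero ?_, hd⟩
  rintro rfl
  exact hr (zero_dvd_iff.1 (hd x₀ hx₀ hj))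

theorem X_dvd_sub_C (f : K⟦X⟧) :
    PowerSeries.X ∣ f - algebraMap K K⟦X⟧ (PowerSeries.constantCoeff f) := by
  rw [PowerSeries.X_dvd_iff]
  simp

/-- Subrings of `K[[t]]` have constant residues. -/
theorem residueConstant_branch (S : Subalgebra K K⟦X⟧) : ResidueConstant S := fun s _ =>
  ⟨PowerSeries.constantCoeff s, mem_jacobson_iff.2 (X_dvd_sub_C s)⟩

theorem residueConstant_iff {S : Subalgebra K (Ambient K)} : ResidueConstant S ↔
    ∀ s ∈ S, PowerSeries.constantCoeff s.1 = PowerSeries.constantCoeff s.2 := by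
  constructor
  · intro h s hs
    obtain ⟨k, hk⟩ := h s hs
    obtain ⟨h1, h2⟩ := mem_jacobson_prod_iff.1 hk
    rw [PowerSeries.X_dvd_iff] at h1 h2
    simp only [Prod.fst_sub, Prod.snd_sub, Prod.algebraMap_apply, map_sub, sub_eq_zero] at h1 h2
    rw [h1, h2]
  · intro h s hs
    refine ⟨PowerSeries.constantCoeff s.1, mem_jacobson_prod_iff.2 ⟨X_dvd_sub_C s.1, ?_⟩⟩
    rw [h s hs]
    exact X_dvd_sub_C s.2

end PowerSeriesFacts

/-! ### Closed subrings -/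

section Closed

variable {K : Type*} [Field K]

/-- `S` is closed in `K[[t]] × K[[u]]` for the topology given by the orders. -/
def OrderClosed (S : Subalgebra K (Ambient K)) : Prop :=
  ∀ z, (∀ N : ℕ, z ∈ thicken (tau (N, N)) S) → z ∈ S

theorem mem_seriesRing_iff {n : ℕ} {y : Fin n → Ambient K} {z : Ambient K} :
    z ∈ seriesRing y ↔ ∀ N : ℕ, z ∈ thicken (tau (N, N)) (Algebra.adjoin K (Set.range y)) := by
  simp only [mem_thicken, tau_dvd_iff_le_val]
  rfl

theorem adjoin_le_seriesRing {n : ℕ} (y : Fin n → Ambient K) :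
    Algebra.adjoin K (Set.range y) ≤ seriesRing y :=
  fun _ h => mem_seriesRing_iff.2 fun _ => le_thicken _ _ h

theorem orderClosed_seriesRing {n : ℕ} (y : Fin n → Ambient K) : OrderClosed (seriesRing y) := by
  refine fun z hz => mem_seriesRing_iff.2 fun N => ?_
  obtain ⟨s, hs, h⟩ := hz N
  obtain ⟨p, hp, h'⟩ := mem_seriesRing_iff.1 hs N
  exact ⟨p, hp, by simpa using dvd_add h h'⟩

theorem tau_dvd_of_mem_jacobson {z : Ambient K}
    (h : z ∈ Ideal.jacobson (⊥ : Ideal (Ambient K))) (N : ℕ) : tau (N, N) ∣ z ^ N := by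
  obtain ⟨h1, h2⟩ := mem_jacobson_prod_iff.1 h
  exact tau_dvd_iff.2 ⟨pow_dvd_pow_of_dvd h1 N, pow_dvd_pow_of_dvd h2 N⟩

theorem OrderClosed.invClosed {S : Subalgebra K (Ambient K)} (hS : OrderClosed S) :
    InvClosed S := by
  intro s hs t hst
  have e1 := congrArg Prod.fst hst
  have e2 := congrArg Prod.snd hst
  simp only [Prod.fst_mul, Prod.snd_mul, Prod.fst_one, Prod.snd_one] at e1 e2
  set k₁ := PowerSeries.constantCoeff s.1 with hk₁
  set k₂ := PowerSeries.constantCoeff s.2 with hk₂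
  have h1 : k₁ ≠ 0 := fun h => by simpa [← hk₁, h] using congrArg PowerSeries.constantCoeff e1
  have h2 : k₂ ≠ 0 := fun h => by simpa [← hk₂, h] using congrArg PowerSeries.constantCoeff e2
  set a₁ := algebraMap K (Ambient K) k₁⁻¹
  set a₂ := algebraMap K (Ambient K) k₂⁻¹
  have ha₁ : a₁ ∈ S := S.algebraMap_mem _
  have ha₂ : a₂ ∈ S := S.algebraMap_mem _
  -- two factors are needed, since the constant terms of `s` may differ
  set p := (1 - a₁ * s) * (1 - a₂ * s) with hp
  have hpS : p ∈ S := mul_mem (sub_mem (one_mem _) (mul_mem ha₁ hs))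
    (sub_mem (one_mem _) (mul_mem ha₂ hs))
  have hpj : p ∈ Ideal.jacobson (⊥ : Ideal (Ambient K)) := by
    refine mem_jacobson_prod_iff.2 ⟨?_, ?_⟩
    · refine Dvd.dvd.mul_right (PowerSeries.X_dvd_iff.2 ?_) _
      simp [a₁, ← hk₁, h1]
    · refine Dvd.dvd.mul_left (PowerSeries.X_dvd_iff.2 ?_) _
      simp [a₂, ← hk₂, h2]
  set q := a₁ + a₂ - a₁ * a₂ * s with hq
  have hpq : 1 - p = s * q := by rw [hp, hq]; ring
  -- `t = q / (1 - p)` is the limit of the partial sums of the geometric series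
  refine hS t fun N => ⟨q * ∑ i ∈ Finset.range N, p ^ i, ?_, ?_⟩
  · exact mul_mem (sub_mem (add_mem ha₁ ha₂) (mul_mem (mul_mem ha₁ ha₂) hs))
      (sum_mem fun i _ => pow_mem hpS i)
  · have hgeom := mul_neg_geom_sum p N
    have e : t - q * ∑ i ∈ Finset.range N, p ^ i = t * p ^ N := by
      rw [hpq] at hgeom
      linear_combination (-t) * hgeom + (q * ∑ i ∈ Finset.range N, p ^ i) * hst
    rw [e]
    exact (tau_dvd_of_mem_jacobson hpj N).mul_left _

/-- A closed subring with a nonconstant residue contains the idempotent `(1, 0)`: if `e` has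
constant terms `(1, 0)`, this idempotent is the limit of `1 - (1 - e ^ N) ^ N`. -/
theorem OrderClosed.idempotent_mem {S : Subalgebra K (Ambient K)} (hS : OrderClosed S)
    (h : ¬ ResidueConstant S) : ((1, 0) : Ambient K) ∈ S := by
  rw [residueConstant_iff] at h
  push Not at h
  obtain ⟨s, hs, hne⟩ := h
  set k₁ := PowerSeries.constantCoeff s.1 with hk₁
  set k₂ := PowerSeries.constantCoeff s.2 with hk₂
  set e := algebraMap K (Ambient K) (k₁ - k₂)⁻¹ * (s - algebraMap K (Ambient K) k₂) with he
  have heS : e ∈ S := mul_mem (S.algebraMap_mem _) (sub_mem hs (S.algebraMap_mem _))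
  have h1 : PowerSeries.X ∣ 1 - e.1 := by
    rw [PowerSeries.X_dvd_iff]
    simp [he, ← hk₁, inv_mul_cancel₀ (sub_ne_zero.2 hne)]
  have h2 : PowerSeries.X ∣ e.2 := by
    rw [PowerSeries.X_dvd_iff]
    simp [he, ← hk₂]
  refine hS _ fun N => ⟨1 - (1 - e ^ N) ^ N,
    sub_mem (one_mem _) (pow_mem (sub_mem (one_mem _) (pow_mem heS N)) N), ?_⟩
  refine tau_dvd_iff.2 ⟨?_, ?_⟩
  · have e1 : (((1, 0) : Ambient K) - (1 - (1 - e ^ N) ^ N)).1 = (1 - e.1 ^ N) ^ N := by simp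
    rw [e1]
    refine pow_dvd_pow_of_dvd (h1.trans ?_) N
    simpa using sub_dvd_pow_sub_pow 1 e.1 N
  · have e2 : (((1, 0) : Ambient K) - (1 - (1 - e ^ N) ^ N)).2 = -(1 - (1 - e.2 ^ N) ^ N) := by
      simp
    rw [e2, dvd_neg]
    refine (pow_dvd_pow_of_dvd h2 N).trans ?_
    simpa using sub_dvd_pow_sub_pow 1 (1 - e.2 ^ N) N

section Finite

open PowerSeries in
/-- The powers `X ^ i` with `i < ord a` generate `K[[X]]` as a module over the power series in `a`:
repeated division by `a` gives the expansion of `f` in powers of `a`, with polynomials of degree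
less than `ord a` as coefficients. -/
theorem exists_eq_sum_of_map_X {φ : K⟦X⟧ →ₐ[K] K⟦X⟧} {a : K⟦X⟧} (ha : φ X = a) (ha0 : a ≠ 0)
    (haX : X ∣ a) (f : K⟦X⟧) :
    ∃ g : ℕ → K⟦X⟧, f = ∑ i ∈ Finset.range a.order.toNat, φ (g i) * X ^ i := by
  set p := a.order.toNat with hp
  have hap : a ∣ X ^ p := by
    rw [dvd_iff_order_le, order_X_pow, hp, coe_toNat_order ha0]
  have hdiv : ∀ f : K⟦X⟧, ∃ q, f = (∑ i ∈ Finset.range p, C (coeff i f) * X ^ i) + a * q := by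
    intro f
    have h : X ^ p ∣ f - ∑ i ∈ Finset.range p, C (coeff i f) * X ^ i := by
      rw [X_pow_dvd_iff]
      intro m hm
      simp [coeff_X_pow, hm]
    obtain ⟨q, hq⟩ := hap.trans h
    exact ⟨q, by rw [← hq]; ring⟩
  choose Q hQ using hdiv
  set G : ℕ → ℕ → K⟦X⟧ := fun k i => mk fun j => coeff i (Q^[k + j] f) with hG
  have hGs : ∀ k i, G k i = C (coeff i (Q^[k] f)) + X * G (k + 1) i := by
    intro k i
    ext m
    cases m with
    | zero => simp [hG]
    | succ m =>
      rw [map_add, coeff_succ_X_mul]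
      simp only [hG, coeff_mk, coeff_C, Nat.add_eq_zero_iff, one_ne_zero, and_false, if_false,
        zero_add]
      congr 2
      omega
  have hφC : ∀ k : K, φ (C k) = C k := fun k => φ.commutes k
  have hstep : ∀ k, Q^[k] f - ∑ i ∈ Finset.range p, φ (G k i) * X ^ i =
      a * (Q^[k + 1] f - ∑ i ∈ Finset.range p, φ (G (k + 1) i) * X ^ i) := by
    intro k
    rw [Function.iterate_succ_apply', mul_sub, Finset.mul_sum]
    have h1 : ∀ i, φ (G k i) * X ^ i =
        C (coeff i (Q^[k] f)) * X ^ i + a * (φ (G (k + 1) i) * X ^ i) := by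
      intro i
      rw [hGs k i, map_add, map_mul, hφC, ha]; ring
    simp only [h1, Finset.sum_add_distrib]
    linear_combination hQ (Q^[k] f)
  have hpow : ∀ N k, a ^ N ∣ Q^[k] f - ∑ i ∈ Finset.range p, φ (G k i) * X ^ i := by
    intro N
    induction N with
    | zero => simp
    | succ N ih =>
      intro k
      rw [hstep k, pow_succ']
      exact mul_dvd_mul_left _ (ih _)
  refine ⟨G 0, sub_eq_zero.1 ?_⟩
  ext m
  have h := (pow_dvd_pow_of_dvd haX (m + 1)).trans (hpow (m + 1) 0)
  rw [X_pow_dvd_iff] at h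
  simpa using h m (Nat.lt_succ_self m)

/-- `A` is spanned by finitely many elements over `K[[X]]`, acting through `φ`. -/
def FinitelySpans {A : Type*} [CommRing A] [Algebra K A] (φ : K⟦X⟧ →ₐ[K] A) : Prop :=
  ∃ (ι : Type) (_ : Fintype ι) (e : ι → A), ∀ z, ∃ c : ι → K⟦X⟧, z = ∑ i, φ (c i) * e i

open PowerSeries in
/-- The `K`-algebra homomorphism `f ↦ f(x)` into `K[[t]] × K[[u]]`, for `x` without constant
terms, makes `K[[t]] × K[[u]]` a finite `K[[X]]`-module if `x` is regular. -/
theorem exists_finitelySpans {x : Ambient K} (hr : x ∈ nonZeroDivisors (Ambient K))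
    (hj : x ∈ Ideal.jacobson (⊥ : Ideal (Ambient K))) :
    ∃ φ : K⟦X⟧ →ₐ[K] Ambient K, φ X = x ∧ FinitelySpans φ := by
  obtain ⟨j1, j2⟩ := mem_jacobson_prod_iff.1 hj
  obtain ⟨r1, r2⟩ := mem_nonZeroDivisors_prod_iff.1 hr
  have s1 : HasSubst x.1 := HasSubst.of_constantCoeff_zero' (X_dvd_iff.1 j1)
  have s2 : HasSubst x.2 := HasSubst.of_constantCoeff_zero' (X_dvd_iff.1 j2)
  set φ₁ : K⟦X⟧ →ₐ[K] K⟦X⟧ := substAlgHom s1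
  set φ₂ : K⟦X⟧ →ₐ[K] K⟦X⟧ := substAlgHom s2
  have e1 : φ₁ X = x.1 := substAlgHom_X s1
  have e2 : φ₂ X = x.2 := substAlgHom_X s2
  refine ⟨φ₁.prod φ₂, Prod.ext e1 e2, Fin x.1.order.toNat ⊕ Fin x.2.order.toNat, inferInstance,
    Sum.elim (fun i => (X ^ (i : ℕ), 0)) (fun i => (0, X ^ (i : ℕ))), fun z => ?_⟩
  obtain ⟨g, hg⟩ := exists_eq_sum_of_map_X e1 r1 j1 z.1
  obtain ⟨h, hh⟩ := exists_eq_sum_of_map_X e2 r2 j2 z.2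
  refine ⟨Sum.elim (fun i => g i) (fun i => h i), ?_⟩
  rw [Finset.sum_range] at hg hh
  rw [Fintype.sum_sum_type]
  refine Prod.ext ?_ ?_
  · rw [Prod.fst_add, Prod.fst_sum, Prod.fst_sum]
    simpa using hg
  · rw [Prod.snd_add, Prod.snd_sum, Prod.snd_sum]
    simpa using hh

open PowerSeries in
/-- Krull's intersection theorem for the finite `K[[X]]`-module `A / T`. -/
theorem FinitelySpans.mem_of_forall_pow_dvd {A : Type*} [CommRing A] [Algebra K A]
    {φ : K⟦X⟧ →ₐ[K] A} (hφ : FinitelySpans φ) {T : Subalgebra K A} (hT : φ.range ≤ T) {z : A}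
    (hz : ∀ i : ℕ, ∃ s ∈ T, φ X ^ i ∣ z - s) : z ∈ T := by
  let := φ.toRingHom.toAlgebra
  have hsm : ∀ (g : K⟦X⟧) (w : A), g • w = φ g * w := fun g w => Algebra.smul_def g w
  have : Module.Finite K⟦X⟧ A := by
    obtain ⟨ι, _, e, he⟩ := hφ
    refine Module.Finite.of_surjective (Fintype.linearCombination K⟦X⟧ e) fun z => ?_
    obtain ⟨c, rfl⟩ := he z
    exact ⟨c, by simp only [Fintype.linearCombination_apply, hsm]⟩
  let M : Submodule K⟦X⟧ A :=
    { carrier := T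
      add_mem' := fun h h' => add_mem h h'
      zero_mem' := zero_mem T
      smul_mem' := fun g w hw => by
        rw [hsm]
        exact mul_mem (hT ⟨g, rfl⟩) hw }
  have hI : (Ideal.span {X} : Ideal K⟦X⟧) ≠ ⊤ := by
    rw [← PowerSeries.maximalIdeal_eq_span_X]
    exact (IsLocalRing.maximalIdeal.isMaximal _).ne_top
  have krull := Ideal.iInf_pow_smul_eq_bot_of_isLocalRing (M := A ⧸ M) _ hI
  have hmem : M.mkQ z ∈ (⨅ i : ℕ, (Ideal.span {X} : Ideal K⟦X⟧) ^ i • ⊤ :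
      Submodule K⟦X⟧ (A ⧸ M)) := by
    refine (Submodule.mem_iInf _).2 fun i => ?_
    obtain ⟨s, hs, w, hw⟩ := hz i
    have e : M.mkQ z = (X ^ i : K⟦X⟧) • M.mkQ w := by
      rw [← map_smul, hsm, map_pow, ← hw, map_sub]
      have : M.mkQ s = 0 := (Submodule.Quotient.mk_eq_zero M).2 hs
      rw [this, sub_zero]
    rw [e]
    exact Submodule.smul_mem_smul (Ideal.pow_mem_pow (Ideal.mem_span_singleton_self _) i)
      Submodule.mem_top
  rw [krull, Submodule.mem_bot] at hmem
  exact (Submodule.Quotient.mk_eq_zero M).1 hmem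

open PowerSeries in
/-- A closed subring that contains `x` contains all power series in `x`. -/
theorem OrderClosed.range_le {S : Subalgebra K (Ambient K)} (hS : OrderClosed S) {x : Ambient K}
    (hx : x ∈ S) (hj : x ∈ Ideal.jacobson (⊥ : Ideal (Ambient K)))
    {φ : K⟦X⟧ →ₐ[K] Ambient K} (hφ : φ X = x) : φ.range ≤ S := by
  rintro _ ⟨f, rfl⟩
  change φ f ∈ S
  refine hS _ fun N => ?_
  have h : X ^ N ∣ f - ∑ i ∈ Finset.range N, C (coeff i f) * X ^ i := by
    rw [X_pow_dvd_iff]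
    intro m hm
    simp [coeff_X_pow, hm]
  refine ⟨φ (∑ i ∈ Finset.range N, C (coeff i f) * X ^ i), ?_, ?_⟩
  · rw [map_sum]
    refine sum_mem fun i _ => ?_
    rw [map_mul, map_pow, hφ]
    refine mul_mem ?_ (pow_mem hx i)
    have : φ (C (coeff i f)) = algebraMap K _ (coeff i f) := φ.commutes _
    rw [this]
    exact S.algebraMap_mem _
  · rw [← map_sub]
    refine (tau_dvd_of_mem_jacobson hj N).trans ?_
    rw [← hφ, ← map_pow]
    exact map_dvd φ h

/-- A ring between the ring of power series in a regular element `x` and `K[[t]] × K[[u]]` is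
closed. -/
theorem orderClosed_of_range_le {T : Subalgebra K (Ambient K)} {x : Ambient K}
    (hr : x ∈ nonZeroDivisors (Ambient K)) {φ : K⟦X⟧ →ₐ[K] Ambient K} (hφ : φ PowerSeries.X = x)
    (hfin : FinitelySpans φ) (hT : φ.range ≤ T) : OrderClosed T := by
  refine fun z hz => hfin.mem_of_forall_pow_dvd hT fun i => ?_
  obtain ⟨N, hN⟩ := exists_dvd_tau hr i
  obtain ⟨s, hs, hd⟩ := hz N
  exact ⟨s, hs, hφ ▸ hN.trans hd⟩

end Finite

/-- `S` contains a regular element of the Jacobson radical, and all rings between `S` and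
`K[[t]] × K[[u]]` are closed. -/
structure Admissible (S : Subalgebra K (Ambient K)) : Prop where
  exists_regular : ∃ x ∈ S, x ∈ nonZeroDivisors (Ambient K) ∧
    x ∈ Ideal.jacobson (⊥ : Ideal (Ambient K))
  closed : ∀ T, S ≤ T → OrderClosed T

theorem Admissible.mono {S T : Subalgebra K (Ambient K)} (hS : Admissible S) (h : S ≤ T) :
    Admissible T := by
  obtain ⟨x, hx, h'⟩ := hS.exists_regular
  exact ⟨⟨x, h hx, h'⟩, fun U hU => hS.closed U (h.trans hU)⟩

theorem Admissible.invClosed {S T : Subalgebra K (Ambient K)} (hS : Admissible S) (h : S ≤ T) :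
    InvClosed T :=
  (hS.closed T h).invClosed

theorem OrderClosed.admissible {S : Subalgebra K (Ambient K)} (hS : OrderClosed S)
    {x : Ambient K} (hx : x ∈ S) (hr : x ∈ nonZeroDivisors (Ambient K))
    (hj : x ∈ Ideal.jacobson (⊥ : Ideal (Ambient K))) : Admissible S := by
  obtain ⟨φ, hφ, hfin⟩ := exists_finitelySpans hr hj
  exact ⟨⟨x, hx, hr, hj⟩, fun T hT =>
    orderClosed_of_range_le hr hφ hfin ((hS.range_le hx hj hφ).trans hT)⟩

/-- If all elements of `K[[t]] × K[[u]]` are fractions of elements of `S`, these fractions have a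
common denominator. -/
theorem exists_conductor_element {S : Subalgebra K (Ambient K)} (hS : OrderClosed S)
    {x : Ambient K} (hx : x ∈ S) (hr : x ∈ nonZeroDivisors (Ambient K))
    (hj : x ∈ Ideal.jacobson (⊥ : Ideal (Ambient K)))
    (hf : ∀ z, ∃ b ∈ S, b ∈ nonZeroDivisors (Ambient K) ∧ b * z ∈ S) :
    ∃ d ∈ nonZeroDivisors (Ambient K), ∀ z, d ∣ z → z ∈ S := by
  obtain ⟨φ, hφ, ι, _, e, he⟩ := exists_finitelySpans hr hj
  have hle := hS.range_le hx hj hφ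
  choose b hbS hbr hb using hf
  refine ⟨∏ i, b (e i), prod_mem fun i _ => hbr _, ?_⟩
  rintro _ ⟨w, rfl⟩
  obtain ⟨c, rfl⟩ := he w
  rw [Finset.mul_sum]
  refine sum_mem fun i _ => ?_
  rw [mul_left_comm]
  refine mul_mem (hle ⟨c i, rfl⟩) ?_
  classical
  rw [← Finset.prod_erase_mul Finset.univ (fun i => b (e i)) (Finset.mem_univ i), mul_assoc]
  exact mul_mem (prod_mem fun i _ => hbS _) (hb _)

end Closed

/-! ### The conductor -/

section Conductor

variable {K : Type*} [Field K]

theorem val_tau (c : ℕ × ℕ) : val (tau c : Ambient K) = ((c.1 : ℕ∞), (c.2 : ℕ∞)) :=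
  Prod.ext (PowerSeries.order_X_pow _) (PowerSeries.order_X_pow _)

/-- Adding elements of values `(a, b')` and `(a', b)` with `a < a'` and `b < b'` gives an element
of value `(a, b)`. -/
theorem val_add {s s' : Ambient K} {a b a' b' : ℕ} (hs : val s = ((a : ℕ∞), (b' : ℕ∞)))
    (hs' : val s' = ((a' : ℕ∞), (b : ℕ∞))) (ha : a < a') (hb : b < b') :
    val (s + s') = ((a : ℕ∞), (b : ℕ∞)) := by
  obtain ⟨h1, h2⟩ := Prod.ext_iff.1 hs
  obtain ⟨h3, h4⟩ := Prod.ext_iff.1 hs'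
  simp only [val] at h1 h2 h3 h4
  refine Prod.ext ?_ ?_
  · change (s.1 + s'.1).order = a
    have hlt : s.1.order < s'.1.order := by rw [h1, h3]; exact_mod_cast ha
    rw [PowerSeries.order_add_of_order_ne _ _ hlt.ne, inf_eq_left.2 hlt.le, h1]
  · change (s.2 + s'.2).order = b
    have hlt : s'.2.order < s.2.order := by rw [h2, h4]; exact_mod_cast hb
    rw [PowerSeries.order_add_of_order_ne _ _ hlt.ne', inf_eq_right.2 hlt.le, h4]

/-- The value set of a ring with a regular conductor element `d` has a conductor: the elements
`δ` with `δ + ℕ²` in the value set are closed under componentwise minima. -/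
theorem exists_isConductor {T : Subalgebra K (Ambient K)} {d : Ambient K}
    (hd : d ∈ nonZeroDivisors (Ambient K)) (hT : ∀ z, d ∣ z → z ∈ T) :
    ∃ c, IsConductor (valueSet T) c := by
  set C : Set (ℕ × ℕ) := {δ | ∀ β, δ ≤ β → β ∈ valueSet T} with hC
  have hne : natVal d ∈ C := fun β hβ =>
    ⟨tau β, hT _ ((dvd_tau_natVal hd).trans (tau_dvd_tau hβ)), val_tau β⟩
  obtain ⟨δ, hδ, hδm⟩ := exists_minimalFor_of_wellFoundedLT (· ∈ C) Prod.fst ⟨_, hne⟩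
  obtain ⟨ε, hε, hεm⟩ := exists_minimalFor_of_wellFoundedLT (· ∈ C) Prod.snd ⟨_, hne⟩
  refine ⟨(δ.1, ε.2), ?_, fun γ hγ => ⟨?_, ?_⟩⟩
  · rintro ⟨a, b⟩ ⟨ha, hb⟩
    obtain ⟨s, hs, hsv⟩ := hδ (a, max (b + 1) δ.2) ⟨ha, le_max_right _ _⟩
    obtain ⟨s', hs', hsv'⟩ := hε (max (a + 1) ε.1, b) ⟨le_max_right _ _, hb⟩
    exact ⟨s + s', add_mem hs hs', val_add hsv hsv' (Nat.lt_of_succ_le (le_max_left _ _))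
      (Nat.lt_of_succ_le (le_max_left _ _))⟩
  · exact (le_total δ.1 γ.1).elim id fun h => hδm hγ h
  · exact (le_total ε.2 γ.2).elim id fun h => hεm hγ h

open PowerSeries in
theorem exists_smul_cancel {f s : K⟦X⟧} {n : ℕ} (hf : X ^ n ∣ f) (hs : s.order = n) :
    ∃ k : K, X ^ (n + 1) ∣ f - k • s := by
  obtain ⟨hsn, hs'⟩ := order_eq_nat.1 hs
  refine ⟨coeff n f * (coeff n s)⁻¹, X_pow_dvd_iff.2 fun m hm => ?_⟩
  rw [map_sub, coeff_smul, smul_eq_mul]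
  rcases Nat.lt_succ_iff_lt_or_eq.1 hm with h | rfl
  · rw [X_pow_dvd_iff.1 hf m h, hs' m h, mul_zero, sub_zero]
  · rw [inv_mul_cancel_right₀ hsn, sub_self]

/-- A closed ring contains all elements whose value is at least the conductor of its value set:
the elements of the ring realize all leading terms beyond the conductor. -/
theorem OrderClosed.mem_of_isConductor {T : Subalgebra K (Ambient K)} (hT : OrderClosed T)
    {c : ℕ × ℕ} (hc : IsConductor (valueSet T) c) {z : Ambient K} (hz : tau c ∣ z) : z ∈ T := by
  have key : ∀ k : ℕ, ∃ s ∈ T, tau (max k c.1, max k c.2) ∣ z - s := by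
    intro k
    induction k with
    | zero => exact ⟨0, zero_mem _, by simpa using hz⟩
    | succ k ih =>
      obtain ⟨s, hs, hd⟩ := ih
      obtain ⟨d1, d2⟩ := tau_dvd_iff.1 hd
      set a := max k c.1 with ha
      set b := max k c.2 with hb
      obtain ⟨p, hp, hpv⟩ := hc.1 (a, b + 1)
        ⟨le_max_right _ _, Nat.le_succ_of_le (le_max_right _ _)⟩
      obtain ⟨q, hq, hqv⟩ := hc.1 (a + 1, b)
        ⟨Nat.le_succ_of_le (le_max_right _ _), le_max_right _ _⟩
      obtain ⟨p1, p2⟩ := Prod.ext_iff.1 hpv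
      obtain ⟨q1, q2⟩ := Prod.ext_iff.1 hqv
      simp only [val] at p1 p2 q1 q2
      obtain ⟨α, hα⟩ := exists_smul_cancel d1 p1
      obtain ⟨β, hβ⟩ := exists_smul_cancel d2 q2
      refine ⟨s + (α • p + β • q),
        add_mem hs (add_mem (T.smul_mem hp α) (T.smul_mem hq β)), ?_⟩
      refine (tau_dvd_tau (d := (a + 1, b + 1)) ⟨?_, ?_⟩).trans (tau_dvd_iff.2 ⟨?_, ?_⟩)
      · change max (k + 1) c.1 ≤ a + 1
        omega
      · change max (k + 1) c.2 ≤ b + 1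
        omega
      · have e : (z - (s + (α • p + β • q))).1 = ((z - s).1 - α • p.1) - β • q.1 := by
          simp only [Prod.fst_sub, Prod.fst_add, Prod.smul_fst]; ring
        rw [e]
        exact dvd_sub hα (dvd_smul_of_dvd _ (X_pow_dvd_iff_le_order.2 q1.ge))
      · have e : (z - (s + (α • p + β • q))).2 = ((z - s).2 - β • q.2) - α • p.2 := by
          simp only [Prod.snd_sub, Prod.snd_add, Prod.smul_snd]; ring
        rw [e]
        exact dvd_sub hβ (dvd_smul_of_dvd _ (X_pow_dvd_iff_le_order.2 p2.ge))
  refine hT z fun N => ?_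
  obtain ⟨s, hs, hd⟩ := key N
  exact ⟨s, hs, (tau_dvd_tau ⟨le_max_left _ _, le_max_left _ _⟩).trans hd⟩

end Conductor

/-! ### Products of two branches -/

section Product

variable {K : Type*} [Field K] {S₁ S₂ : Subalgebra K K⟦X⟧}

theorem eq_prod_of_idempotent_mem {S : Subalgebra K (Ambient K)} (h : ((1, 0) : Ambient K) ∈ S) :
    ∃ S₁ S₂ : Subalgebra K K⟦X⟧, S = S₁.prod S₂ := by
  refine ⟨S.map (AlgHom.fst K _ _), S.map (AlgHom.snd K _ _), ?_⟩
  ext z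
  rw [Subalgebra.mem_prod]
  constructor
  · exact fun hz => ⟨⟨z, hz, rfl⟩, ⟨z, hz, rfl⟩⟩
  · rintro ⟨⟨a, ha, ha'⟩, ⟨b, hb, hb'⟩⟩
    have e : z = (1, 0) * a + (1 - (1, 0)) * b := by
      refine Prod.ext ?_ ?_
      · simpa using ha'.symm
      · simpa using hb'.symm
    rw [e]
    exact add_mem (mul_mem h ha) (mul_mem (sub_mem (one_mem _) h) hb)

theorem prod_injective {T₁ T₂ : Subalgebra K K⟦X⟧} (h : S₁.prod S₂ = T₁.prod T₂) :
    S₁ = T₁ ∧ S₂ = T₂ := by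
  constructor
  · ext z
    simpa [Subalgebra.mem_prod, zero_mem] using SetLike.ext_iff.1 h (z, 0)
  · ext z
    simpa [Subalgebra.mem_prod, zero_mem] using SetLike.ext_iff.1 h (0, z)

theorem InvClosed.of_prod (h : InvClosed (S₁.prod S₂)) : InvClosed S₁ ∧ InvClosed S₂ := by
  constructor
  · intro s hs t hst
    exact (Subalgebra.mem_prod.1 (h (s, 1) (Subalgebra.mem_prod.2 ⟨hs, one_mem _⟩) (t, 1)
      (Prod.ext hst (one_mul _)))).1
  · intro s hs t hst
    exact (Subalgebra.mem_prod.1 (h (1, s) (Subalgebra.mem_prod.2 ⟨one_mem _, hs⟩) (1, t)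
      (Prod.ext (one_mul _) hst))).2

theorem IsArfIn.prod (h₁ : IsArfIn S₁) (h₂ : IsArfIn S₂) : IsArfIn (S₁.prod S₂) := by
  rintro x hx hr
  obtain ⟨r1, r2⟩ := mem_nonZeroDivisors_prod_iff.1 hr
  obtain ⟨x1, x2⟩ := Subalgebra.mem_prod.1 hx
  obtain ⟨T₁, e1⟩ := h₁ x.1 x1 (mem_nonZeroDivisors_of_ne_zero r1)
  obtain ⟨T₂, e2⟩ := h₂ x.2 x2 (mem_nonZeroDivisors_of_ne_zero r2)
  refine ⟨T₁.prod T₂, ?_⟩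
  rw [Subring.coe_prod, e1, e2]
  rfl

theorem IsArfIn.of_prod (h : IsArfIn (S₁.prod S₂)) : IsArfIn S₁ ∧ IsArfIn S₂ := by
  constructor
  · intro x hx hr
    obtain ⟨T, hT⟩ := h (x, 1) (Subalgebra.mem_prod.2 ⟨hx, one_mem _⟩)
      (mem_nonZeroDivisors_prod_iff.2 ⟨nonZeroDivisors.ne_zero hr, one_ne_zero⟩)
    refine ⟨T.map (RingHom.fst _ _), ?_⟩
    rw [Subring.coe_map, hT]
    ext z
    constructor
    · rintro ⟨w, hw, rfl⟩
      exact (Subalgebra.mem_prod.1 hw).1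
    · intro hz
      exact ⟨(z, 0), Subalgebra.mem_prod.2 ⟨hz, by simp⟩, rfl⟩
  · intro x hx hr
    obtain ⟨T, hT⟩ := h (1, x) (Subalgebra.mem_prod.2 ⟨one_mem _, hx⟩)
      (mem_nonZeroDivisors_prod_iff.2 ⟨one_ne_zero, nonZeroDivisors.ne_zero hr⟩)
    refine ⟨T.map (RingHom.snd _ _), ?_⟩
    rw [Subring.coe_map, hT]
    ext z
    constructor
    · rintro ⟨w, hw, rfl⟩
      exact (Subalgebra.mem_prod.1 hw).2
    · intro hz
      exact ⟨(0, z), Subalgebra.mem_prod.2 ⟨by simp, hz⟩, rfl⟩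

theorem arfContains_prod_iff {c : ℕ × ℕ} : ArfContains (S₁.prod S₂) (tau c : Ambient K) ↔
    ArfContains S₁ (PowerSeries.X ^ c.1) ∧ ArfContains S₂ (PowerSeries.X ^ c.2) := by
  constructor
  · intro h
    constructor
    · intro B hB hA z hz
      exact (Subalgebra.mem_prod.1 (h (B.prod ⊤) (Subalgebra.prod_mono hB le_top)
        (hA.prod isArfIn_top) (z, 0) (tau_dvd_iff.2 ⟨hz, dvd_zero _⟩))).1
    · intro B hB hA z hz
      exact (Subalgebra.mem_prod.1 (h (Subalgebra.prod ⊤ B) (Subalgebra.prod_mono le_top hB)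
        (isArfIn_top.prod hA) (0, z) (tau_dvd_iff.2 ⟨dvd_zero _, hz⟩))).2
  · rintro ⟨h1, h2⟩ B hB hA z hz
    obtain ⟨B₁, B₂, rfl⟩ := eq_prod_of_idempotent_mem
      (hB (Subalgebra.mem_prod.2 ⟨one_mem _, zero_mem _⟩))
    obtain ⟨A1, A2⟩ := hA.of_prod
    obtain ⟨z1, z2⟩ := tau_dvd_iff.1 hz
    refine Subalgebra.mem_prod.2 ⟨h1 B₁ (fun s hs => ?_) A1 _ z1, h2 B₂ (fun s hs => ?_) A2 _ z2⟩
    · exact (Subalgebra.mem_prod.1 (hB (Subalgebra.mem_prod.2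
        (⟨hs, zero_mem _⟩ : ((s, 0) : Ambient K).1 ∈ S₁ ∧ _)))).1
    · exact (Subalgebra.mem_prod.1 (hB (Subalgebra.mem_prod.2
        (⟨zero_mem _, hs⟩ : ((0, s) : Ambient K).1 ∈ S₁ ∧ _)))).2

theorem congrMod_prod_iff {T₁ T₂ : Subalgebra K K⟦X⟧} {c : ℕ × ℕ} :
    CongrMod (tau c : Ambient K) (S₁.prod S₂) (T₁.prod T₂) ↔
      CongrMod (PowerSeries.X ^ c.1) S₁ T₁ ∧ CongrMod (PowerSeries.X ^ c.2) S₂ T₂ := by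
  have key : ∀ {S₁ S₂ T₁ T₂ : Subalgebra K K⟦X⟧},
      S₁.prod S₂ ≤ thicken (tau c : Ambient K) (T₁.prod T₂) ↔
      S₁ ≤ thicken (PowerSeries.X ^ c.1) T₁ ∧ S₂ ≤ thicken (PowerSeries.X ^ c.2) T₂ := by
    intro S₁ S₂ T₁ T₂
    constructor
    · intro h
      constructor
      · intro s hs
        obtain ⟨t, ht, hd⟩ := h (Subalgebra.mem_prod.2
          (⟨hs, zero_mem _⟩ : ((s, 0) : Ambient K).1 ∈ S₁ ∧ _))
        exact ⟨t.1, (Subalgebra.mem_prod.1 ht).1, (tau_dvd_iff.1 hd).1⟩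
      · intro s hs
        obtain ⟨t, ht, hd⟩ := h (Subalgebra.mem_prod.2
          (⟨zero_mem _, hs⟩ : ((0, s) : Ambient K).1 ∈ S₁ ∧ _))
        exact ⟨t.2, (Subalgebra.mem_prod.1 ht).2, (tau_dvd_iff.1 hd).2⟩
    · rintro ⟨h1, h2⟩ s hs
      obtain ⟨s1, s2⟩ := Subalgebra.mem_prod.1 hs
      obtain ⟨t1, ht1, d1⟩ := h1 s1
      obtain ⟨t2, ht2, d2⟩ := h2 s2
      exact ⟨(t1, t2), Subalgebra.mem_prod.2 ⟨ht1, ht2⟩, tau_dvd_iff.2 ⟨d1, d2⟩⟩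
  simp only [CongrMod, key]
  tauto

open PowerSeries in
/-- A closed subring of `K[[t]]` that contains an element of order `1` is `K[[t]]`. -/
theorem eq_top_of_order_eq_one {S : Subalgebra K K⟦X⟧}
    (hS : ∀ z, (∀ N : ℕ, z ∈ thicken (X ^ N) S) → z ∈ S) {x : K⟦X⟧} (hx : x ∈ S)
    (h1 : x.order = 1) : S = ⊤ := by
  refine eq_top_iff.2 fun z _ => hS z fun N => ?_
  induction N with
  | zero => exact ⟨0, zero_mem _, by simp⟩
  | succ N ih =>
    obtain ⟨s, hs, hd⟩ := ih
    have hxN : (x ^ N).order = N := by rw [order_pow, h1]; simp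
    obtain ⟨k, hk⟩ := exists_smul_cancel hd hxN
    exact ⟨s + k • x ^ N, add_mem hs (S.smul_mem (pow_mem hx N) k), by rwa [← sub_sub]⟩

theorem OrderClosed.branch_closed (h : OrderClosed (S₁.prod S₂)) :
    (∀ z, (∀ N : ℕ, z ∈ thicken (PowerSeries.X ^ N) S₁) → z ∈ S₁) ∧
      ∀ z, (∀ N : ℕ, z ∈ thicken (PowerSeries.X ^ N) S₂) → z ∈ S₂ := by
  constructor
  · intro z hz
    refine (Subalgebra.mem_prod.1 (h (z, 0) fun N => ?_)).1
    obtain ⟨s, hs, hd⟩ := hz N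
    exact ⟨(s, 0), Subalgebra.mem_prod.2 ⟨hs, zero_mem _⟩, tau_dvd_iff.2 ⟨hd, by simp⟩⟩
  · intro z hz
    refine (Subalgebra.mem_prod.1 (h (0, z) fun N => ?_)).2
    obtain ⟨s, hs, hd⟩ := hz N
    exact ⟨(0, s), Subalgebra.mem_prod.2 ⟨zero_mem _, hs⟩, tau_dvd_iff.2 ⟨by simp, hd⟩⟩

end Product

/-! ### One step of the algorithm -/

section Stages

variable {K : Type*} [Field K]

/-- The data carried through the algorithm for a branch: the rings `S` and `T` agree modulo
`t ^ (c + 2)`, and `t ^ c K[[t]]` lies in every Arf ring containing `S`. -/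
structure BranchStage (S T : Subalgebra K K⟦X⟧) (c : ℕ) : Prop where
  invClosed_left : ∀ B, S ≤ B → InvClosed B
  invClosed_right : ∀ B, T ≤ B → InvClosed B
  eq_top_left : ∀ x ∈ S, x.order = 1 → S = ⊤
  eq_top_right : ∀ x ∈ T, x.order = 1 → T = ⊤
  exists_left : ∃ x, IsMinimal S x
  exists_right : ∃ x, IsMinimal T x
  congr : CongrMod (PowerSeries.X ^ (c + 2)) S T
  arf : ArfContains S (PowerSeries.X ^ c)

theorem IsMinimal.exists_order_eq {S : Subalgebra K K⟦X⟧} {x : K⟦X⟧} (hx : IsMinimal S x) :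
    ∃ m : ℕ, 1 ≤ m ∧ x.order = m := by
  refine ⟨x.order.toNat, ?_,
    (PowerSeries.coe_toNat_order (nonZeroDivisors.ne_zero hx.regular)).symm⟩
  have h := X_pow_dvd_iff_le_order.1 ((pow_one (PowerSeries.X : K⟦X⟧)).symm ▸
    mem_jacobson_iff.1 hx.mem_jacobson)
  rw [← PowerSeries.coe_toNat_order (nonZeroDivisors.ne_zero hx.regular)] at h
  exact_mod_cast h

theorem order_eq_of_associated {f g : K⟦X⟧} (h : Associated f g) : f.order = g.order :=
  le_antisymm (dvd_iff_order_le.1 h.dvd) (dvd_iff_order_le.1 h.symm.dvd)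

/-- On a branch, either the multiplicity is `1` and the ring is `K[[t]]`, or the conductor is at
least the multiplicity and decreases by it. -/
theorem BranchStage.step {S T : Subalgebra K K⟦X⟧} {c : ℕ} (h : BranchStage S T c) {x y : K⟦X⟧}
    (hx : IsMinimal S x) (hy : IsMinimal T y) :
    ∃ m : ℕ, 1 ≤ m ∧ x.order = m ∧ y.order = m ∧ (m = 1 ∨ m ≤ c) ∧
      CongrMod (PowerSeries.X ^ (c - m + 2)) (blowUp S x) (blowUp T y) ∧
      ArfContains (blowUp S x) (PowerSeries.X ^ (c - m)) := by
  have hSi := h.invClosed_left S le_rfl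
  have hTi := h.invClosed_right T le_rfl
  have hSc := residueConstant_branch S
  have hTc := residueConstant_branch T
  have hleS := le_blowUp hSi hSc hx
  have hleT := le_blowUp hTi hTc hy
  have hXj : ∀ k, k ≠ 0 → (PowerSeries.X ^ k : K⟦X⟧) ∈ Ideal.jacobson (⊥ : Ideal K⟦X⟧) :=
    fun k hk => mem_jacobson_iff.2 (dvd_pow_self _ hk)
  have hdvd : ∀ (m k l : ℕ), x.order = m → m + k ≤ l →
      x * PowerSeries.X ^ k ∣ PowerSeries.X ^ l := by
    intro m k l hm hl
    rw [dvd_iff_order_le, PowerSeries.order_mul, PowerSeries.order_X_pow, PowerSeries.order_X_pow,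
      hm]
    exact_mod_cast hl
  obtain ⟨m, hm1, hm⟩ := hx.exists_order_eq
  rcases hm1.eq_or_lt with rfl | hm2
  · have hxy : x.order = y.order := order_eq_of_associated
      (hx.associated_of_congrMod h.congr (hXj (c + 1) (by omega)) (hdvd 1 _ _ hm (by omega)) hy)
    have hS : S = ⊤ := h.eq_top_left x hx.mem hm
    have hT : T = ⊤ := h.eq_top_right y hy.mem (hxy ▸ hm)
    have hS' : blowUp S x = ⊤ := top_le_iff.1 (hS.symm.le.trans hleS)
    have hT' : blowUp T y = ⊤ := top_le_iff.1 (hT.symm.le.trans hleT)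
    refine ⟨1, le_rfl, hm, hxy ▸ hm, Or.inl rfl, ?_, ?_⟩
    · rw [hS', hT']
      exact ⟨le_thicken _ _, le_thicken _ _⟩
    · rw [hS']
      exact fun B hB _ z _ => hB Algebra.mem_top
  · -- for `c = 0`, the ring `K + x K[[t]]` would contain `t`
    have hc : c ≠ 0 := by
      rintro rfl
      obtain ⟨k, b, -, he⟩ := h.arf _ (le_constAdd hSi hSc hx le_top)
        (isArfIn_top.constAdd (h.invClosed_left ⊤ le_top) Algebra.mem_top hx.regular
          hx.mem_jacobson) PowerSeries.X (by simp)
      have hk : k = 0 := by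
        refine eq_zero_of_add_mem_jacobson (Ideal.mul_mem_right b _ hx.mem_jacobson) ?_
        rw [← he]
        exact mem_jacobson_iff.2 dvd_rfl
      have hle : x ∣ PowerSeries.X := ⟨b, by simpa [hk] using he⟩
      rw [dvd_iff_order_le, hm, PowerSeries.order_X] at hle
      have : m ≤ 1 := by exact_mod_cast hle
      omega
    obtain ⟨hxc, harf⟩ := h.arf.blowUp h.invClosed_left hSc hx (hXj c hc)
    have hmc : m ≤ c := by
      rw [dvd_iff_order_le, hm, PowerSeries.order_X_pow] at hxc
      exact_mod_cast hxc
    have hd := hdvd m (c - m + 2) (c + 2) hm (by omega)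
    refine ⟨m, hm1, hm, ?_, Or.inr hmc, ?_, ?_⟩
    · rw [← hm]
      exact (order_eq_of_associated
        (hx.associated_of_congrMod h.congr (hXj _ (by omega)) hd hy)).symm
    · exact h.congr.blowUp hSi hSc hTi (h.invClosed_left _ hleS) (h.invClosed_right _ hleT) hx hy
        (hXj _ (by omega)) hd
    · refine harf _ ?_
      rw [dvd_iff_order_le, PowerSeries.order_mul, hm, PowerSeries.order_X_pow,
        PowerSeries.order_X_pow]
      exact_mod_cast (by omega : c ≤ m + (c - m))

/-- The data carried through the algorithm: the rings `S` and `T` agree in degrees at most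
`c + 1`, and all elements of value at least `c` lie in every Arf ring containing `S`. -/
structure Stage (S T : Subalgebra K (Ambient K)) (c : ℕ × ℕ) : Prop where
  admissible_left : Admissible S
  admissible_right : Admissible T
  congr : CongrMod (tau (c.1 + 2, c.2 + 2)) S T
  arf : ArfContains S (tau c)

theorem Admissible.branch {S₁ S₂ : Subalgebra K K⟦X⟧} (h : Admissible (S₁.prod S₂)) :
    ((∀ B, S₁ ≤ B → InvClosed B) ∧ (∀ x ∈ S₁, x.order = 1 → S₁ = ⊤) ∧ ∃ x, IsMinimal S₁ x) ∧
    (∀ B, S₂ ≤ B → InvClosed B) ∧ (∀ x ∈ S₂, x.order = 1 → S₂ = ⊤) ∧ ∃ x, IsMinimal S₂ x := by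
  obtain ⟨c1, c2⟩ := (h.closed _ le_rfl).branch_closed
  obtain ⟨x, hx, hr, hj⟩ := h.exists_regular
  obtain ⟨x1, x2⟩ := Subalgebra.mem_prod.1 hx
  obtain ⟨r1, r2⟩ := mem_nonZeroDivisors_prod_iff.1 hr
  obtain ⟨j1, j2⟩ := mem_jacobson_prod_iff.1 hj
  refine ⟨⟨fun B hB => ?_, fun x hx h1 => eq_top_of_order_eq_one c1 hx h1,
    exists_isMinimal_branch x1 r1 (mem_jacobson_iff.2 j1)⟩,
    fun B hB => ?_, fun x hx h1 => eq_top_of_order_eq_one c2 hx h1,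
    exists_isMinimal_branch x2 r2 (mem_jacobson_iff.2 j2)⟩
  · exact (h.invClosed (Subalgebra.prod_mono hB le_rfl)).of_prod.1
  · exact (h.invClosed (Subalgebra.prod_mono le_rfl hB)).of_prod.2

theorem Stage.branch {S₁ S₂ T₁ T₂ : Subalgebra K K⟦X⟧} {c : ℕ × ℕ}
    (h : Stage (S₁.prod S₂) (T₁.prod T₂) c) : BranchStage S₁ T₁ c.1 ∧ BranchStage S₂ T₂ c.2 := by
  obtain ⟨⟨i1, t1, m1⟩, i2, t2, m2⟩ := h.admissible_left.branch
  obtain ⟨⟨i1', t1', m1'⟩, i2', t2', m2'⟩ := h.admissible_right.branch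
  obtain ⟨a1, a2⟩ := arfContains_prod_iff.1 h.arf
  obtain ⟨g1, g2⟩ := congrMod_prod_iff.1 h.congr
  exact ⟨⟨i1, i1', t1, t1', m1, m1', g1, a1⟩, ⟨i2, i2', t2, t2', m2, m2', g2, a2⟩⟩

theorem not_residueConstant_prod (S₁ S₂ : Subalgebra K K⟦X⟧) :
    ¬ ResidueConstant (S₁.prod S₂ : Subalgebra K (Ambient K)) := by
  intro h
  have := residueConstant_iff.1 h (1, 0) (Subalgebra.mem_prod.2 ⟨one_mem _, zero_mem _⟩)
  simp at this

theorem not_isLocalRing_of_idempotent_mem {S : Subalgebra K (Ambient K)}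
    (h : ((1, 0) : Ambient K) ∈ S) : ¬ IsLocalRing S := by
  intro hl
  have key : ∀ a : S, IsUnit a → IsUnit (a : Ambient K).1 ∧ IsUnit (a : Ambient K).2 :=
    fun a ha => Prod.isUnit_iff.1 (ha.map S.val)
  rcases IsLocalRing.isUnit_or_isUnit_one_sub_self (⟨(1, 0), h⟩ : S) with hu | hu
  · simpa using (key _ hu).2
  · simpa using (key _ hu).1

/-- For a local ring, the second case in the definition of `multStar` does not occur. -/
theorem ResidueConstant.multStar_eq {S : Subalgebra K (Ambient K)} (hi : InvClosed S)
    (hc : ResidueConstant S) {x : Ambient K} (hx : IsMinimal S x) : multStar S = {natVal x} := by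
  have hn : ∀ S₁ S₂, ¬ SplitsAs S S₁ S₂ := fun S₁ S₂ h =>
    not_residueConstant_prod S₁ S₂ (h.1 ▸ hc)
  ext v
  simp only [multStar, hn, false_and, exists_false, or_false, isLocalRing_of_residueConstant hi hc,
    true_and, Set.mem_ofPred_eq, Set.mem_singleton_iff, isMult_iff hi hc hx,
    val_eq_natVal hx.regular, Prod.ext_iff, Nat.cast_inj]
  exact and_congr eq_comm eq_comm

theorem ResidueConstant.step_iff {S S' : Subalgebra K (Ambient K)} (hi : InvClosed S)
    (hc : ResidueConstant S) : Step S S' ↔ ∃ x, IsMinimal S x ∧ S' = blowUp S x := by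
  have hn : ∀ S₁ S₂, ¬ SplitsAs S S₁ S₂ := fun S₁ S₂ h =>
    not_residueConstant_prod S₁ S₂ (h.1 ▸ hc)
  constructor
  · rintro (⟨-, v, hv, x, hx, hxv, rfl⟩ | ⟨S₁, S₂, h, -⟩)
    · obtain ⟨hxS, hxj⟩ := (mem_maxIdeal_iff hi hc).1 hx
      refine ⟨x, ⟨hxS, hxj, mem_nonZeroDivisors_prod_iff.2 ⟨?_, ?_⟩, fun r hr hrj => ?_⟩, rfl⟩
      · intro h0
        have := congrArg Prod.fst hxv
        simp [val, h0] at this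
      · intro h0
        have := congrArg Prod.snd hxv
        simp [val, h0] at this
      · rw [← val_le_val_iff, hxv]
        exact hv.2 ⟨r, (mem_maxIdeal_iff hi hc).2 ⟨hr, hrj⟩, rfl⟩
    · exact absurd h (hn _ _)
  · rintro ⟨x, hx, rfl⟩
    exact Or.inl ⟨isLocalRing_of_residueConstant hi hc, natVal x,
      (isMult_iff hi hc hx).2 (val_eq_natVal hx.regular), x,
      (mem_maxIdeal_iff hi hc).2 ⟨hx.mem, hx.mem_jacobson⟩, val_eq_natVal hx.regular, rfl⟩

section Split

variable {S₁ S₂ : Subalgebra K K⟦X⟧}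

theorem splitsAs_prod (h₁ : InvClosed S₁) (h₂ : InvClosed S₂) :
    SplitsAs (S₁.prod S₂) S₁ S₂ :=
  ⟨rfl, isLocalRing_of_residueConstant h₁ (residueConstant_branch _),
    isLocalRing_of_residueConstant h₂ (residueConstant_branch _)⟩

theorem multStar_prod (h₁ : InvClosed S₁) (h₂ : InvClosed S₂) {x₁ x₂ : K⟦X⟧}
    (hx₁ : IsMinimal S₁ x₁) (hx₂ : IsMinimal S₂ x₂) {m₁ m₂ : ℕ} (hm₁ : x₁.order = m₁)
    (hm₂ : x₂.order = m₂) : multStar (S₁.prod S₂) = {(m₁, 0), (0, m₂)} := by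
  have hl := not_isLocalRing_of_idempotent_mem (S := S₁.prod S₂)
    (Subalgebra.mem_prod.2 ⟨one_mem _, zero_mem _⟩)
  have key : ∀ v : ℕ × ℕ, v ∈ multStar (S₁.prod S₂) ↔
      (IsBranchMult S₁ v.1 ∧ v.2 = 0) ∨ (v.1 = 0 ∧ IsBranchMult S₂ v.2) := by
    intro v
    constructor
    · rintro (⟨h, -⟩ | ⟨T₁, T₂, hT, h⟩)
      · exact absurd h hl
      · obtain ⟨rfl, rfl⟩ := prod_injective hT.1
        exact h
    · exact fun h => Or.inr ⟨S₁, S₂, splitsAs_prod h₁ h₂, h⟩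
  ext v
  rw [key, isBranchMult_iff h₁ (residueConstant_branch _) hx₁,
    isBranchMult_iff h₂ (residueConstant_branch _) hx₂, hm₁, hm₂]
  simp only [Nat.cast_inj, Set.mem_insert_iff, Set.mem_singleton_iff, Prod.ext_iff]
  tauto

theorem isMinimal_of_isBranchMult {S : Subalgebra K K⟦X⟧} (h : InvClosed S) {x : K⟦X⟧} {m : ℕ}
    (hx : x ∈ maxIdeal S) (hm : IsBranchMult S m) (hxm : x.order = m) : IsMinimal S x := by
  have hc := residueConstant_branch S
  obtain ⟨hxS, hxj⟩ := (mem_maxIdeal_iff h hc).1 hx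
  refine ⟨hxS, hxj, mem_nonZeroDivisors_of_ne_zero ?_, fun r hr hrj => ?_⟩
  · rintro rfl
    simp at hxm
  · rw [dvd_iff_order_le, hxm]
    exact hm.2 ⟨r, (mem_maxIdeal_iff h hc).2 ⟨hr, hrj⟩, rfl⟩

theorem step_prod_iff (h₁ : InvClosed S₁) (h₂ : InvClosed S₂)
    {S' : Subalgebra K (Ambient K)} : Step (S₁.prod S₂) S' ↔
      ∃ x₁ x₂, IsMinimal S₁ x₁ ∧ IsMinimal S₂ x₂ ∧ S' = (blowUp S₁ x₁).prod (blowUp S₂ x₂) := by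
  have hl := not_isLocalRing_of_idempotent_mem (S := S₁.prod S₂)
    (Subalgebra.mem_prod.2 ⟨one_mem _, zero_mem _⟩)
  constructor
  · rintro (⟨h, -⟩ | ⟨T₁, T₂, hT, m₁, m₂, hm₁, hm₂, x₁, hx₁, x₂, hx₂, e₁, e₂, rfl⟩)
    · exact absurd h hl
    · obtain ⟨rfl, rfl⟩ := prod_injective hT.1
      exact ⟨x₁, x₂, isMinimal_of_isBranchMult h₁ hx₁ hm₁ e₁,
        isMinimal_of_isBranchMult h₂ hx₂ hm₂ e₂, rfl⟩
  · rintro ⟨x₁, x₂, hx₁, hx₂, rfl⟩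
    obtain ⟨m₁, -, e₁⟩ := hx₁.exists_order_eq
    obtain ⟨m₂, -, e₂⟩ := hx₂.exists_order_eq
    have c₁ := residueConstant_branch S₁
    have c₂ := residueConstant_branch S₂
    exact Or.inr ⟨S₁, S₂, splitsAs_prod h₁ h₂, m₁, m₂, (isBranchMult_iff h₁ c₁ hx₁).2 e₁,
      (isBranchMult_iff h₂ c₂ hx₂).2 e₂, x₁,
      (mem_maxIdeal_iff h₁ c₁).2 ⟨hx₁.mem, hx₁.mem_jacobson⟩, x₂,
      (mem_maxIdeal_iff h₂ c₂).2 ⟨hx₂.mem, hx₂.mem_jacobson⟩, e₁, e₂, rfl⟩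

end Split

/-- A local ring does not have conductor `0` in any component: it lies in the Arf ring `K + xA`,
`A = K[[t]] × K[[u]]`, whose elements have equal constant terms in both components. -/
theorem ArfContains.ne_zero {S : Subalgebra K (Ambient K)} {c : ℕ × ℕ} (h : ArfContains S (tau c))
    (ha : Admissible S) (hc : ResidueConstant S) {x : Ambient K} (hx : IsMinimal S x) :
    c.1 ≠ 0 ∧ c.2 ≠ 0 := by
  have key : ∀ z : Ambient K, tau c ∣ z →
      PowerSeries.constantCoeff z.1 = PowerSeries.constantCoeff z.2 := by
    intro z hz
    have hT : ResidueConstant (constAdd (⊤ : Subalgebra K (Ambient K)) x Algebra.mem_top) := by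
      rintro _ ⟨k, b, -, rfl⟩
      exact ⟨k, by simpa using Ideal.mul_mem_right b _ hx.mem_jacobson⟩
    exact residueConstant_iff.1 hT z (h _ (le_constAdd (ha.invClosed le_rfl) hc hx le_top)
      (isArfIn_top.constAdd (ha.invClosed le_top) _ hx.regular hx.mem_jacobson) z hz)
  constructor
  · intro h0
    have := key (1, PowerSeries.X ^ (c.2 + 1))
      (tau_dvd_iff.2 ⟨by simp [h0], pow_dvd_pow _ (by simp)⟩)
    simp at this
  · intro h0
    have := key (PowerSeries.X ^ (c.1 + 1), 1)
      (tau_dvd_iff.2 ⟨pow_dvd_pow _ (by simp), by simp [h0]⟩)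
    simp at this

theorem ArfContains.natVal_le {S : Subalgebra K (Ambient K)} {c : ℕ × ℕ}
    (h : ArfContains S (tau c)) (ha : Admissible S) (hc : ResidueConstant S) {x : Ambient K}
    (hx : IsMinimal S x) : natVal x ≤ c := by
  obtain ⟨c1, c2⟩ := h.ne_zero ha hc hx
  have hd := (h.blowUp (fun B => ha.invClosed) hc hx (tau_mem_jacobson c1 c2)).1
  rw [← val_le_val_iff, val_tau, val_eq_natVal hx.regular] at hd
  exact ⟨Nat.cast_le.1 hd.1, Nat.cast_le.1 hd.2⟩

theorem IsMinimal.natVal_pos {S : Subalgebra K (Ambient K)} {x : Ambient K} (hx : IsMinimal S x) :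
    1 ≤ (natVal x).1 ∧ 1 ≤ (natVal x).2 := by
  obtain ⟨h1, h2⟩ := mem_jacobson_prod_iff.1 hx.mem_jacobson
  have h : ((1 : ℕ) : ℕ∞) ≤ (val x).1 ∧ ((1 : ℕ) : ℕ∞) ≤ (val x).2 :=
    ⟨X_pow_dvd_iff_le_order.1 (by simpa using h1), X_pow_dvd_iff_le_order.1 (by simpa using h2)⟩
  rw [val_eq_natVal hx.regular] at h
  exact ⟨Nat.cast_le.1 h.1, Nat.cast_le.1 h.2⟩

theorem natVal_eq_of_associated {x y : Ambient K} (h : Associated x y) : natVal x = natVal y := by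
  have e : val x = val y := le_antisymm (val_le_val_iff.2 h.dvd) (val_le_val_iff.2 h.symm.dvd)
  exact Prod.ext (congrArg (fun v => v.1.toNat) e) (congrArg (fun v => v.2.toNat) e)

/-- A step of the algorithm while both rings are local. -/
theorem Stage.step_local {S T : Subalgebra K (Ambient K)} {c : ℕ × ℕ} (h : Stage S T c)
    (hSc : ResidueConstant S) (hTc : ResidueConstant T) {x y : Ambient K} (hx : IsMinimal S x)
    (hy : IsMinimal T y) :
    natVal x = natVal y ∧ natVal x ≤ c ∧ Stage (blowUp S x) (blowUp T y) (c - natVal x) := by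
  have hSi := h.admissible_left.invClosed le_rfl
  have hTi := h.admissible_right.invClosed le_rfl
  have hleS := le_blowUp hSi hSc hx
  have hleT := le_blowUp hTi hTc hy
  obtain ⟨c1, c2⟩ := h.arf.ne_zero h.admissible_left hSc hx
  have hv := h.arf.natVal_le h.admissible_left hSc hx
  have harf := (h.arf.blowUp (fun B => h.admissible_left.invClosed) hSc hx
    (tau_mem_jacobson c1 c2)).2
  have hj : (tau ((c - natVal x).1 + 2, (c - natVal x).2 + 2) : Ambient K) ∈
      Ideal.jacobson (⊥ : Ideal (Ambient K)) :=
    tau_mem_jacobson (by simp) (by simp)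
  have hg : x * tau ((c - natVal x).1 + 2, (c - natVal x).2 + 2) ∣ tau (c.1 + 2, c.2 + 2) := by
    refine (mul_dvd_mul_right (dvd_tau_natVal hx.regular) _).trans ?_
    rw [← tau_add]
    obtain ⟨h1, h2⟩ := hv
    refine tau_dvd_tau ⟨?_, ?_⟩
    · simp only [Prod.fst_add, Prod.fst_sub]; omega
    · simp only [Prod.snd_add, Prod.snd_sub]; omega
  refine ⟨natVal_eq_of_associated (hx.associated_of_congrMod h.congr hj hg hy), hv,
    h.admissible_left.mono hleS, h.admissible_right.mono hleT, ?_, harf _ ?_⟩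
  · exact h.congr.blowUp hSi hSc hTi (h.admissible_left.invClosed hleS)
      (h.admissible_right.invClosed hleT) hx hy hj hg
  · refine dvd_trans ?_ (mul_dvd_mul_right (tau_natVal_dvd hx.regular) _)
    rw [← tau_add, add_tsub_cancel_of_le hv]

/-- A step of the algorithm after the branches have separated. -/
theorem Stage.step_split {S₁ S₂ T₁ T₂ : Subalgebra K K⟦X⟧} {c : ℕ × ℕ}
    (h : Stage (S₁.prod S₂) (T₁.prod T₂) c) {x₁ x₂ y₁ y₂ : K⟦X⟧} (hx₁ : IsMinimal S₁ x₁)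
    (hx₂ : IsMinimal S₂ x₂) (hy₁ : IsMinimal T₁ y₁) (hy₂ : IsMinimal T₂ y₂) :
    ∃ m : ℕ × ℕ, multStar (S₁.prod S₂) = {(m.1, 0), (0, m.2)} ∧
      multStar (T₁.prod T₂) = {(m.1, 0), (0, m.2)} ∧
      Stage ((blowUp S₁ x₁).prod (blowUp S₂ x₂)) ((blowUp T₁ y₁).prod (blowUp T₂ y₂)) (c - m) ∧
      (m ≠ (1, 1) → (c - m).1 + (c - m).2 < c.1 + c.2) := by
  obtain ⟨b₁, b₂⟩ := h.branch
  obtain ⟨m₁, l₁, ex₁, ey₁, d₁, g₁, a₁⟩ := b₁.step hx₁ hy₁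
  obtain ⟨m₂, l₂, ex₂, ey₂, d₂, g₂, a₂⟩ := b₂.step hx₂ hy₂
  have iS₁ := b₁.invClosed_left S₁ le_rfl
  have iS₂ := b₂.invClosed_left S₂ le_rfl
  have iT₁ := b₁.invClosed_right T₁ le_rfl
  have iT₂ := b₂.invClosed_right T₂ le_rfl
  refine ⟨(m₁, m₂), multStar_prod iS₁ iS₂ hx₁ hx₂ ex₁ ex₂, multStar_prod iT₁ iT₂ hy₁ hy₂ ey₁ ey₂,
    ⟨?_, ?_, ?_, ?_⟩, fun hm => ?_⟩
  · exact h.admissible_left.mono (Subalgebra.prod_mono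
      (le_blowUp iS₁ (residueConstant_branch _) hx₁) (le_blowUp iS₂ (residueConstant_branch _) hx₂))
  · exact h.admissible_right.mono (Subalgebra.prod_mono
      (le_blowUp iT₁ (residueConstant_branch _) hy₁) (le_blowUp iT₂ (residueConstant_branch _) hy₂))
  · exact congrMod_prod_iff.2 ⟨g₁, g₂⟩
  · exact arfContains_prod_iff.2 ⟨a₁, a₂⟩
  · simp only [Prod.fst_sub, Prod.snd_sub]
    have : m₁ ≠ 1 ∨ m₂ ≠ 1 := by
      by_contra hne
      push Not at hne
      exact hm (Prod.ext hne.1 hne.2)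
    omega

/-- One step of the algorithm on two rings in parallel: the multiplicities agree, and every choice
of the elements of minimal value leads to rings that are again related. -/
theorem Stage.step {S T : Subalgebra K (Ambient K)} {c : ℕ × ℕ} (h : Stage S T c) :
    multStar S = multStar T ∧ (∃ S', Step S S') ∧ (∃ T', Step T T') ∧
      ∀ S' T', Step S S' → Step T T' → ∃ c', Stage S' T' c' ∧
        (multStar S ≠ {(1, 0), (0, 1)} → c'.1 + c'.2 < c.1 + c.2) := by
  have hSi := h.admissible_left.invClosed le_rfl
  have hTi := h.admissible_right.invClosed le_rfl
  have hj : (tau (c.1 + 2, c.2 + 2) : Ambient K) ∈ Ideal.jacobson (⊥ : Ideal (Ambient K)) :=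
    tau_mem_jacobson (by simp) (by simp)
  by_cases hSc : ResidueConstant S
  · have hTc := hSc.of_congrMod hj h.congr
    obtain ⟨x₀, hx₀, r, j⟩ := h.admissible_left.exists_regular
    obtain ⟨x, hx⟩ := exists_isMinimal hx₀ r j
    obtain ⟨y₀, hy₀, r', j'⟩ := h.admissible_right.exists_regular
    obtain ⟨y, hy⟩ := exists_isMinimal hy₀ r' j'
    refine ⟨?_, ⟨_, (hSc.step_iff hSi).2 ⟨x, hx, rfl⟩⟩, ⟨_, (hTc.step_iff hTi).2 ⟨y, hy, rfl⟩⟩, ?_⟩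
    · rw [hSc.multStar_eq hSi hx, hTc.multStar_eq hTi hy, (h.step_local hSc hTc hx hy).1]
    · intro S' T' hS' hT'
      obtain ⟨x, hx, rfl⟩ := (hSc.step_iff hSi).1 hS'
      obtain ⟨y, hy, rfl⟩ := (hTc.step_iff hTi).1 hT'
      obtain ⟨-, ⟨l1, l2⟩, hst⟩ := h.step_local hSc hTc hx hy
      refine ⟨_, hst, fun _ => ?_⟩
      obtain ⟨p1, p2⟩ := hx.natVal_pos
      simp only [Prod.fst_sub, Prod.snd_sub]
      omega
  · have hTc : ¬ ResidueConstant T := fun hT => hSc (hT.of_congrMod hj h.congr.symm)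
    obtain ⟨S₁, S₂, rfl⟩ := eq_prod_of_idempotent_mem
      ((h.admissible_left.closed S le_rfl).idempotent_mem hSc)
    obtain ⟨T₁, T₂, rfl⟩ := eq_prod_of_idempotent_mem
      ((h.admissible_right.closed T le_rfl).idempotent_mem hTc)
    obtain ⟨b₁, b₂⟩ := h.branch
    obtain ⟨x₁, hx₁⟩ := b₁.exists_left
    obtain ⟨x₂, hx₂⟩ := b₂.exists_left
    obtain ⟨y₁, hy₁⟩ := b₁.exists_right
    obtain ⟨y₂, hy₂⟩ := b₂.exists_right
    obtain ⟨iS₁, iS₂⟩ := hSi.of_prod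
    obtain ⟨iT₁, iT₂⟩ := hTi.of_prod
    obtain ⟨m, eS, eT, -, -⟩ := h.step_split hx₁ hx₂ hy₁ hy₂
    refine ⟨eS.trans eT.symm, ⟨_, (step_prod_iff iS₁ iS₂).2 ⟨x₁, x₂, hx₁, hx₂, rfl⟩⟩,
      ⟨_, (step_prod_iff iT₁ iT₂).2 ⟨y₁, y₂, hy₁, hy₂, rfl⟩⟩, fun S' T' hS' hT' => ?_⟩
    obtain ⟨x₁, x₂, hx₁, hx₂, rfl⟩ := (step_prod_iff iS₁ iS₂).1 hS'
    obtain ⟨y₁, y₂, hy₁, hy₂, rfl⟩ := (step_prod_iff iT₁ iT₂).1 hT'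
    obtain ⟨m, eS, -, hst, hlt⟩ := h.step_split hx₁ hx₂ hy₁ hy₂
    refine ⟨_, hst, fun hne => hlt ?_⟩
    rintro rfl
    exact hne eS

end Stages

/-! ### Runs of the algorithm -/

section Runs

variable {K : Type*} [Field K]

theorem IsRun.cons {S S' : Subalgebra K (Ambient K)} {m : ℕ} {ρ : ℕ → Subalgebra K (Ambient K)}
    (h : IsRun S' m ρ) (hS : multStar S ≠ {(1, 0), (0, 1)}) (hstep : Step S S') :
    IsRun S (m + 1) (fun i => if i ≤ 1 then S else ρ (i - 1)) := by
  have h1 := h.one_le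
  refine ⟨by omega, by simp, fun i hi him => ?_, ?_⟩
  · rcases hi.eq_or_lt with rfl | hi
    · simpa [h.start] using ⟨hS, hstep⟩
    · have := h.step (i - 1) (by omega) (by omega)
      rw [Nat.sub_add_cancel (by omega)] at this
      simpa [show ¬ i ≤ 1 by omega, show i ≠ 0 by omega] using this
  · simpa [show m ≠ 0 by omega] using h.halt

/-- The algorithm halts, since the sum of the components of the conductor decreases. -/
theorem Stage.exists_isRun {S T : Subalgebra K (Ambient K)} {c : ℕ × ℕ} (h : Stage S T c) :
    (∃ m ρ, IsRun S m ρ) ∧ ∃ m ρ, IsRun T m ρ := by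
  induction hn : c.1 + c.2 using Nat.strong_induction_on generalizing S T c with
  | _ n ih =>
    obtain ⟨heq, ⟨S', hS'⟩, ⟨T', hT'⟩, hstep⟩ := h.step
    by_cases hh : multStar S = {(1, 0), (0, 1)}
    · exact ⟨⟨1, fun _ => S, le_rfl, rfl, fun i hi hi' => by omega, hh⟩,
        ⟨1, fun _ => T, le_rfl, rfl, fun i hi hi' => by omega, heq ▸ hh⟩⟩
    · obtain ⟨c', hst, hlt⟩ := hstep S' T' hS' hT'
      obtain ⟨⟨m, ρ, hρ⟩, ⟨m', ρ', hρ'⟩⟩ := ih _ (hn ▸ hlt hh) hst rfl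
      exact ⟨⟨_, _, hρ.cons hh hS'⟩, ⟨_, _, hρ'.cons (heq ▸ hh) hT'⟩⟩

theorem Stage.multTree_eq {S T : Subalgebra K (Ambient K)} {c : ℕ × ℕ} (h : Stage S T c)
    {m m' : ℕ} {ρ ρ' : ℕ → Subalgebra K (Ambient K)} (hρ : IsRun S m ρ) (hρ' : IsRun T m' ρ') :
    multTree m ρ = multTree m' ρ' := by
  have key : ∀ i, i + 1 ≤ m → i + 1 ≤ m' → ∃ c, Stage (ρ (i + 1)) (ρ' (i + 1)) c := by
    intro i
    induction i with
    | zero =>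
      intro _ _
      rw [zero_add, hρ.start, hρ'.start]
      exact ⟨c, h⟩
    | succ i ih =>
      intro hi hi'
      obtain ⟨c, hc⟩ := ih (by omega) (by omega)
      obtain ⟨c', hc', -⟩ := hc.step.2.2.2 _ _ (hρ.step (i + 1) (by omega) (by omega)).2
        (hρ'.step (i + 1) (by omega) (by omega)).2
      exact ⟨c', hc'⟩
  have heq : ∀ i, 1 ≤ i → i ≤ m → i ≤ m' → multStar (ρ i) = multStar (ρ' i) := by
    intro i hi him him'
    obtain ⟨j, rfl⟩ := Nat.exists_eq_add_of_le' hi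
    obtain ⟨c, hc⟩ := key j him him'
    exact hc.step.1
  have hm := hρ.one_le
  have hm' := hρ'.one_le
  have hmm : m = m' := by
    rcases lt_trichotomy m m' with hlt | rfl | hlt
    · exact absurd (heq m hm le_rfl hlt.le ▸ hρ.halt) (hρ'.step m hm hlt).1
    · rfl
    · exact absurd (heq m' hm' hlt.le le_rfl ▸ hρ'.halt) (hρ.step m' hm' hlt).1
  subst hmm
  have hnode : ∀ p : ℕ × (ℕ × ℕ), (1 ≤ p.1 ∧ p.1 ≤ m ∧ p.2 ∈ multStar (ρ p.1)) =
      (1 ≤ p.1 ∧ p.1 ≤ m ∧ p.2 ∈ multStar (ρ' p.1)) := by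
    intro p
    refine propext (and_congr_right fun h1 => and_congr_right fun h2 => ?_)
    rw [heq p.1 h1 h2 h2]
  refine LevelledTree.ext ?_ ?_
  · simp only [multTree, hnode]
  · simp only [multTree, hnode]

end Runs

/-! ### Truncated parametrizations -/

section Truncation

variable {K : Type*} [Field K]

theorem tau_dvd_sub_truncate (c : ℕ × ℕ) (z : Ambient K) :
    tau (c.1 + 2, c.2 + 2) ∣ z - truncate c z := by
  refine tau_dvd_iff.2 ⟨?_, ?_⟩
  · refine PowerSeries.X_pow_dvd_iff.2 fun m hm => ?_
    simp [truncate, PowerSeries.coeff_trunc, show m < c.1 + 2 from hm]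
  · refine PowerSeries.X_pow_dvd_iff.2 fun m hm => ?_
    simp [truncate, PowerSeries.coeff_trunc, show m < c.2 + 2 from hm]

theorem seriesRing_le_thicken {n : ℕ} {y y' : Fin n → Ambient K} {d : ℕ × ℕ}
    (h : ∀ i, tau d ∣ y i - y' i) : seriesRing y ≤ thicken (tau d) (seriesRing y') := by
  intro z hz
  obtain ⟨p, hp, hd⟩ := mem_seriesRing_iff.1 hz (max d.1 d.2)
  have hle : Algebra.adjoin K (Set.range y) ≤ thicken (tau d) (seriesRing y') := by
    refine Algebra.adjoin_le ?_
    rintro _ ⟨i, rfl⟩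
    exact ⟨y' i, adjoin_le_seriesRing y' (Algebra.subset_adjoin ⟨i, rfl⟩), h i⟩
  obtain ⟨s, hs, hd'⟩ := hle hp
  refine ⟨s, hs, ?_⟩
  have := dvd_add ((tau_dvd_tau ⟨le_max_left _ _, le_max_right _ _⟩).trans hd) hd'
  simpa using this

theorem congrMod_truncate {n : ℕ} (y : Fin n → Ambient K) (c : ℕ × ℕ) :
    CongrMod (tau (c.1 + 2, c.2 + 2)) (seriesRing y) (seriesRing fun i => truncate c (y i)) :=
  ⟨seriesRing_le_thicken fun i => tau_dvd_sub_truncate c (y i),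
    seriesRing_le_thicken fun i => by
      rw [← dvd_neg, neg_sub]
      exact tau_dvd_sub_truncate c (y i)⟩

theorem IsTwoBranchCurve.residueConstant {n : ℕ} {y : Fin n → Ambient K}
    (hy : IsTwoBranchCurve y) : ResidueConstant (seriesRing y) := by
  by_contra h
  exact not_isLocalRing_of_idempotent_mem ((orderClosed_seriesRing y).idempotent_mem h) hy.isLocal

/-- The denominator of a fraction representing `(t, 1)` is a regular non-unit. -/
theorem IsTwoBranchCurve.exists_regular {n : ℕ} {y : Fin n → Ambient K}
    (hy : IsTwoBranchCurve y) : ∃ x ∈ seriesRing y, x ∈ nonZeroDivisors (Ambient K) ∧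
      x ∈ Ideal.jacobson (⊥ : Ideal (Ambient K)) := by
  obtain ⟨a, ha, b, hb, hb1, hb2, he⟩ := hy.fraction (PowerSeries.X, 1)
  refine ⟨b, hb, mem_nonZeroDivisors_prod_iff.2 ⟨hb1, hb2⟩, ?_⟩
  have hc := residueConstant_iff.1 hy.residueConstant
  have h := hc a ha
  have h' := hc b hb
  rw [← he] at h
  simp only [Prod.fst_mul, Prod.snd_mul, map_mul, PowerSeries.constantCoeff_X, mul_zero,
    mul_one] at h
  exact mem_jacobson_prod_iff.2
    ⟨PowerSeries.X_dvd_iff.2 (h'.trans h.symm), PowerSeries.X_dvd_iff.2 h.symm⟩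

theorem arfClosure_le {R B : Subalgebra K (Ambient K)} (h : R ≤ B) (hB : IsArfIn B) :
    arfClosure R ≤ B :=
  sInf_le ⟨h, isArf_iff.2 hB⟩

theorem le_arfClosure (R : Subalgebra K (Ambient K)) : R ≤ arfClosure R :=
  le_sInf fun _ h => h.1

theorem ne_zero_of_X_pow_dvd_sub {f g : K⟦X⟧} {n m : ℕ} (hf : f.order = m) (hmn : m < n)
    (h : PowerSeries.X ^ n ∣ f - g) : g ≠ 0 := by
  rintro rfl
  rw [sub_zero, X_pow_dvd_iff_le_order, hf] at h
  have : n ≤ m := by exact_mod_cast h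
  omega

/-- The curve and its truncation at the conductor of the Arf closure are related as required for the
first step. In particular, the truncated ring contains a regular non-unit, since the multiplicity
is at most the conductor. -/
theorem IsTwoBranchCurve.stage {n : ℕ} {y : Fin n → Ambient K} (hy : IsTwoBranchCurve y)
    {c : ℕ × ℕ} (hc : IsConductor (valueSet (arfClosure (seriesRing y))) c) :
    Stage (seriesRing y) (seriesRing fun i => truncate c (y i)) c := by
  obtain ⟨x₀, hx₀, hr, hj⟩ := hy.exists_regular
  have hadm := (orderClosed_seriesRing y).admissible hx₀ hr hj
  have harf : ArfContains (seriesRing y) (tau c) := fun B hB hA z hz =>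
    arfClosure_le hB hA ((hadm.closed _ (le_arfClosure _)).mem_of_isConductor hc hz)
  have hcong := congrMod_truncate y c
  obtain ⟨x, hx⟩ := exists_isMinimal hx₀ hr hj
  obtain ⟨l1, l2⟩ := harf.natVal_le hadm hy.residueConstant hx
  obtain ⟨x', hx', hd⟩ := hcong.1 hx.mem
  obtain ⟨d1, d2⟩ := tau_dvd_iff.1 hd
  obtain ⟨v1, v2⟩ := Prod.ext_iff.1 (val_eq_natVal hx.regular)
  refine ⟨hadm, (orderClosed_seriesRing _).admissible hx' (mem_nonZeroDivisors_prod_iff.2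
    ⟨ne_zero_of_X_pow_dvd_sub v1 (by omega) d1, ne_zero_of_X_pow_dvd_sub v2 (by omega) d2⟩) ?_,
    hcong, harf⟩
  have := Ideal.sub_mem _ hx.mem_jacobson
    (Ideal.mem_of_dvd _ hd (tau_mem_jacobson (by simp) (by simp)))
  simpa using this

theorem IsTwoBranchCurve.exists_isConductor {n : ℕ} {y : Fin n → Ambient K}
    (hy : IsTwoBranchCurve y) :
    ∃ c, IsConductor (valueSet (arfClosure (seriesRing y))) c := by
  obtain ⟨x, hx, hr, hj⟩ := hy.exists_regular
  obtain ⟨d, hd, hdS⟩ := exists_conductor_element (orderClosed_seriesRing y) hx hr hj fun z => by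
    obtain ⟨a, ha, b, hb, hb1, hb2, he⟩ := hy.fraction z
    exact ⟨b, hb, mem_nonZeroDivisors_prod_iff.2 ⟨hb1, hb2⟩, he ▸ ha⟩
  exact AlgebroidCurve.exists_isConductor hd fun z hz => le_arfClosure _ (hdS z hz)

end Truncation

end AlgebroidCurve

end

theorem theorem4p1 {K : Type*} [Field K] {n : ℕ}
    (y : Fin n → AlgebroidCurve.Ambient K) (hy : AlgebroidCurve.IsTwoBranchCurve y) :
    ∃ c : ℕ × ℕ,
      AlgebroidCurve.IsConductor
        (AlgebroidCurve.valueSet (AlgebroidCurve.arfClosure (AlgebroidCurve.seriesRing y))) c ∧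
      (∃ m ρ, AlgebroidCurve.IsRun (AlgebroidCurve.seriesRing y) m ρ) ∧
      (∃ m ρ, AlgebroidCurve.IsRun
        (AlgebroidCurve.seriesRing fun i => AlgebroidCurve.truncate c (y i)) m ρ) ∧
      ∀ m ρ m' ρ',
        AlgebroidCurve.IsRun (AlgebroidCurve.seriesRing y) m ρ →
        AlgebroidCurve.IsRun
          (AlgebroidCurve.seriesRing fun i => AlgebroidCurve.truncate c (y i)) m' ρ' →
        AlgebroidCurve.multTree m ρ = AlgebroidCurve.multTree m' ρ' := by
  obtain ⟨c, hc⟩ := hy.exists_isConductor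
  have h := hy.stage hc
  exact ⟨c, hc, h.exists_isRun.1, h.exists_isRun.2, fun _ _ _ _ hρ hρ' => h.multTree_eq hρ hρ'⟩
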